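/- For a simple graph $G$ with base vertex $x_0$, an $x_0$-cycle is a sequence of arcs $C=(e_1,\dots,e_m)$ forming a closed path from $x_0$ to $x_0$; it is reduced if neither $C$ nor $C^2$ contains an arc immediately followed by its inverse. Let $N^0_m$ be the number of reduced $x_0$-cycles of length $m$; the generalized Ihara zeta function is $\zeta_G(u)=\exp\left(\sum_{m\ge1}\frac{N^0_m}{m}u^m\right)$. Let $\{G_n\}$ be a sequence of finite connected vertex-transitive $(q+1)$-regular simple graphs, with arbitrarily chosen base vertices $x_n$, such that $|V(G_n)|\to\infty$. Let $P_n$ be the transition matrix of the simple random walk on $G_n$ and $\Delta_n=D-A$ its Laplacian, with normalized spectral measures $\mu_{P_n}=\frac1{|V(G_n)|}\sum_{\lambda\in\mathrm{Spec}(P_n)}\delta_\lambda$ and $\mu_{\Delta_n}=\frac1{|V(G_n)|}\sum_{\lambda\in\mathrm{Spec}(\Delta_n)}\delta_\lambda$ (eigenvalues with multiplicity). Let $u\in\mathbb C$ with $q|u|<1$; powers and logarithms below are principal. Then the series defining $\zeta_{G_n}(u)$ converges for every $n$, and: 1. If $\mu_{P_n}$ converges weakly to a probability measure $\mu_P$ on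 $\mathbb R$ (the limiting spectral measure for the transition operator $P$), then the integrand below is $\mu_P$-integrable and $$\lim_{n\to\infty}\zeta_{G_n}(u)^{-1}=(1-u^2)^{(q-1)/2}\exp\left[\int\log\{(1+qu^2)-(q+1)u\lambda\}\,d\mu_P(\lambda)\right].$$ 2. If $\mu_{\Delta_n}$ converges weakly to a probability measure $\mu_\Delta$ on $\mathbb R$ (the limiting spectral measure for the Laplacian $\Delta$), then the integrand below is $\mu_\Delta$-integrable and $$\lim_{n\to\infty}\zeta_{G_n}(u)^{-1}=(1-u^2)^{(q-1)/2}\exp\left[\int\log\{(1+qu^2)-(q+1-\lambda)u\}\,d\mu_\Delta(\lambda)\right].$$ 3. Suppose that $(G_n,x_n)$ converges locally to a connected vertex-transitive $(q+1)$-regular graph $G$ with base vertex $o$, i.e. for every $r$ and all large $n$ the balls of radius $r$ about $x_n$ and about $o$ are isomorphic as rooted graphs. Let $\mu_P$ and $\mu_\Delta$ be the spectral measures at $\delta_o$ of the transition operator $P$ and the Laplacian $\Delta=(q+1)I-A$ acting on $\ell^2(V(G))$. Then $\mu_P$ and $\mu_\Delta$ are probability measures, $\mu_{P_n}\to\mu_P$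 and $\mu_{\Delta_n}\to\mu_\Delta$ weakly (so 1 and 2 apply to them), the series defining $\zeta_G(u)$ converges, $\lim_n\zeta_{G_n}(u)^{-1}=\zeta_G(u)^{-1}$, and $\zeta_G(u)^{-1}$ is equal to both right-hand sides; the Laplacian form is the Chinta–Jorgenson–Karlsson formula for $G$. -/

import Mathlib

open Filter Topology MeasureTheory
open scoped lp CompactlySupported BoundedContinuousFunction InnerProductSpace ENNReal

noncomputable section

namespace IharaLimit

universe v w

/-! ### Graphs, reduced cycles, and the generalized Ihara zeta function -/

/-- A graph is vertex-transitive if its automorphism group acts transitively on the vertices. -/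
def VertexTransitive {V : Type v} (G : SimpleGraph V) : Prop :=
  ∀ x y : V, ∃ φ : G ≃g G, φ x = y

/-- A path (a sequence of consecutive arcs, i.e. a walk) has no backtracking if no arc is
immediately followed by its inverse. -/
def NoBacktracking {V : Type v} {G : SimpleGraph V} {x y : V} (p : G.Walk x y) : Prop :=
  p.darts.IsChain (fun e f => f.symm ≠ e)

/-- A closed path `C` is reduced if neither `C` nor `C ^ 2` has a backtracking. -/
def IsReducedCycle {V : Type v} {G : SimpleGraph V} {x : V} (p : G.Walk x x) : Prop :=
  NoBacktracking p ∧ NoBacktracking (p.append p)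

/-- `N⁰ₘ`: the number of reduced `x`-cycles of length `m`. -/
def numReducedCycles {V : Type v} (G : SimpleGraph V) (x : V) (m : ℕ) : ℕ :=
  Set.ncard {p : G.Walk x x | p.length = m ∧ IsReducedCycle p}

/-- The terms `N⁰ₘ / m * u ^ m` for `m = 1, 2, …` (indexed by `k = m - 1`). -/
def zetaTerm {V : Type v} (G : SimpleGraph V) (x : V) (u : ℂ) (k : ℕ) : ℂ :=
  (numReducedCycles G x (k + 1) : ℂ) / ((k + 1 : ℕ) : ℂ) * u ^ (k + 1)

/-- The generalized Ihara zeta function of `G` with base vertex `x`,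
`exp (∑ₘ N⁰ₘ / m * u ^ m)`. -/
def iharaZeta {V : Type v} (G : SimpleGraph V) (x : V) (u : ℂ) : ℂ :=
  Complex.exp (∑' k : ℕ, zetaTerm G x u k)

/-! ### Spectral measures of finite graphs -/

/-- The transition probability matrix of the simple random walk. -/
def transitionMatrix {V : Type v} [Fintype V] [DecidableEq V] (G : SimpleGraph V)
    [DecidableRel G.Adj] : Matrix V V ℝ :=
  Matrix.of fun x y => if G.Adj x y then 1 / (G.degree x : ℝ) else 0

/-- The normalized spectral measure `(1/n) ∑_{λ ∈ Spec M} δ_λ` of a real `n × n` matrix,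
eigenvalues being counted with multiplicity. -/
def spectralMeasure {V : Type v} [Fintype V] [DecidableEq V] (M : Matrix V V ℝ) : Measure ℝ :=
  (Fintype.card V : ℝ≥0∞)⁻¹ • (M.charpoly.roots.map Measure.dirac).sum

/-- Weak convergence of a sequence of measures on the real line. -/
def WeaklyConverges (μs : ℕ → Measure ℝ) (μ : Measure ℝ) : Prop :=
  ∀ f : ℝ →ᵇ ℝ, Tendsto (fun n => ∫ t, f t ∂(μs n)) atTop (𝓝 (∫ t, f t ∂μ))

/-! ### Local convergence of rooted graphs -/

/-- The (closed) ball of radius `r` about the vertex `x`, in the graph distance. -/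
def closedBall {V : Type v} (G : SimpleGraph V) (x : V) (r : ℕ) : Set V :=
  {y | G.edist x y ≤ r}

/-- Rooted graphs `(G n, x n)` converge locally to `(H, o)`: for each radius `r`, for all large `n`
the ball of radius `r` about `x n` is isomorphic to the ball of radius `r` about `o` by an
isomorphism taking `x n` to `o`. -/
def LocallyConverges {V : ℕ → Type v} (G : ∀ n, SimpleGraph (V n)) (x : ∀ n, V n)
    {W : Type w} (H : SimpleGraph W) (o : W) : Prop :=
  ∀ r : ℕ, ∀ᶠ n in atTop,
    ∃ φ : (G n).induce (closedBall (G n) (x n) r) ≃g H.induce (closedBall H o r),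
      ∀ y : closedBall (G n) (x n) r, (y : V n) = x n → (φ y : W) = o

/-! ### The transition operator and the Laplacian on `ℓ²` of a possibly infinite graph -/

section Operators

variable {W : Type w} (H : SimpleGraph W) [H.LocallyFinite]

theorem sum_norm_sq_le {d : ℕ} (hd : H.IsRegularOfDegree d) (f : ℓ²(W, ℂ)) (s : Finset W) :
    ∑ x ∈ s, ‖∑ y ∈ H.neighborFinset x, f y‖ ^ 2 ≤ ((d : ℝ) * ‖f‖) ^ 2 := by
  classical
  have h1 : ∀ x ∈ s, ‖∑ y ∈ H.neighborFinset x, f y‖ ^ 2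
      ≤ (d : ℝ) * ∑ y ∈ H.neighborFinset x, ‖f y‖ ^ 2 := by
    intro x _
    have hc : ((H.neighborFinset x).card : ℝ) = d := by
      rw [SimpleGraph.card_neighborFinset_eq_degree, hd x]
    calc ‖∑ y ∈ H.neighborFinset x, f y‖ ^ 2
        ≤ (∑ y ∈ H.neighborFinset x, ‖f y‖) ^ 2 := by
          gcongr; exact norm_sum_le _ _
      _ ≤ _ := by rw [← hc]; exact sq_sum_le_card_mul_sum_sq
  have h2 : ∑ x ∈ s, ∑ y ∈ H.neighborFinset x, ‖f y‖ ^ 2 ≤ (d : ℝ) * ‖f‖ ^ 2 := by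
    have : ∑ x ∈ s, ∑ y ∈ H.neighborFinset x, ‖f y‖ ^ 2
        = ∑ y ∈ s.biUnion (fun x => H.neighborFinset x),
            ∑ x ∈ s with x ∈ H.neighborFinset y, ‖f y‖ ^ 2 := by
      apply Finset.sum_comm'
      intro x y
      simp only [Finset.mem_filter, Finset.mem_biUnion, SimpleGraph.mem_neighborFinset]
      constructor
      · rintro ⟨hx, hxy⟩
        exact ⟨⟨hx, hxy.symm⟩, x, hx, hxy⟩
      · rintro ⟨⟨hx, hxy⟩, -⟩
        exact ⟨hx, hxy.symm⟩
    rw [this]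
    calc _ ≤ ∑ y ∈ s.biUnion (fun x => H.neighborFinset x), (d : ℝ) * ‖f y‖ ^ 2 := by
          refine Finset.sum_le_sum fun y _ => ?_
          rw [Finset.sum_const, nsmul_eq_mul]
          gcongr
          rw [← hd y, ← SimpleGraph.card_neighborFinset_eq_degree]
          refine Finset.card_le_card fun x hx => (Finset.mem_filter.1 hx).2
      _ ≤ (d : ℝ) * ‖f‖ ^ 2 := by
          rw [← Finset.mul_sum]
          gcongr
          have := lp.sum_rpow_le_norm_rpow (p := 2) (by norm_num) f
            (s.biUnion (fun x => H.neighborFinset x))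
          simpa using this
  calc _ ≤ ∑ x ∈ s, (d : ℝ) * ∑ y ∈ H.neighborFinset x, ‖f y‖ ^ 2 := Finset.sum_le_sum h1
    _ ≤ (d : ℝ) * ((d : ℝ) * ‖f‖ ^ 2) := by rw [← Finset.mul_sum]; gcongr
    _ = _ := by ring

/-- The adjacency operator `(A f)(x) = ∑_{y ∼ x} f y` on `ℓ²(W)` of a regular graph. -/
def adjacencyOperator {d : ℕ} (hd : H.IsRegularOfDegree d) : ℓ²(W, ℂ) →L[ℂ] ℓ²(W, ℂ) :=
  LinearMap.mkContinuous
    { toFun := fun f => ⟨fun x => ∑ y ∈ H.neighborFinset x, f y, by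
        refine memℓp_gen' (C := ((d : ℝ) * ‖f‖) ^ 2) fun s => ?_
        simpa using sum_norm_sq_le H hd f s⟩
      map_add' := fun f g => by
        ext x
        exact Finset.sum_add_distrib
      map_smul' := fun c f => by
        ext x
        exact (Finset.mul_sum _ _ _).symm }
    d fun f => by
      refine lp.norm_le_of_forall_sum_le (p := 2) (by norm_num) (by positivity) fun s => ?_
      simpa using sum_norm_sq_le H hd f s

/-- The transition operator `P = D⁻¹ A` of the simple random walk on a `d`-regular graph. -/
def transitionOperator {d : ℕ} (hd : H.IsRegularOfDegree d) : ℓ²(W, ℂ) →L[ℂ] ℓ²(W, ℂ) :=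
  ((d : ℂ)⁻¹) • adjacencyOperator H hd

/-- The Laplacian `Δ = D - A` of a `d`-regular graph. -/
def laplacianOperator {d : ℕ} (hd : H.IsRegularOfDegree d) : ℓ²(W, ℂ) →L[ℂ] ℓ²(W, ℂ) :=
  (d : ℂ) • (1 : ℓ²(W, ℂ) →L[ℂ] ℓ²(W, ℂ)) - adjacencyOperator H hd

end Operators

section SpectralMeasure

variable {E : Type w} [NormedAddCommGroup E] [InnerProductSpace ℂ E] [CompleteSpace E]

/-- The positive functional `f ↦ ⟪ξ, f(T) ξ⟫` given by the continuous functional calculus of a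
self-adjoint operator `T`. -/
def spectralFunctional (T : E →L[ℂ] E) (ξ : E) : C_c(ℝ, ℝ) →ₚ[ℝ] ℝ :=
  PositiveLinearMap.mk₀
    { toFun := fun f => (⟪ξ, (cfc (f : ℝ → ℝ) T) ξ⟫_ℂ).re
      map_add' := fun f g => by
        have : cfc ((f + g : C_c(ℝ, ℝ)) : ℝ → ℝ) T = cfc (f : ℝ → ℝ) T + cfc (g : ℝ → ℝ) T :=
          cfc_add (a := T) (f : ℝ → ℝ) (g : ℝ → ℝ) f.continuous.continuousOn
            g.continuous.continuousOn
        rw [this]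
        simp
      map_smul' := fun c f => by
        have : cfc ((c • f : C_c(ℝ, ℝ)) : ℝ → ℝ) T = c • cfc (f : ℝ → ℝ) T :=
          cfc_smul c (f : ℝ → ℝ) T f.continuous.continuousOn
        rw [this]
        simp [inner_smul_right_eq_smul] }
    fun f hf => by
      have h : 0 ≤ cfc (f : ℝ → ℝ) T := cfc_nonneg fun x _ => hf x
      have h' := (ContinuousLinearMap.nonneg_iff_isPositive _).1 h
      exact h'.re_inner_nonneg_right ξ

/-- The spectral measure of the self-adjoint operator `T` at the vector `ξ`: the measure on `ℝ` with
`∫ f dμ = ⟪ξ, f(T) ξ⟫` for all continuous compactly supported `f`. -/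
def operatorSpectralMeasure (T : E →L[ℂ] E) (ξ : E) : Measure ℝ :=
  RealRMK.rieszMeasure (spectralFunctional T ξ)

end SpectralMeasure

/-- The spectral measure of the transition operator of a regular graph at the vertex `o`. -/
def transitionSpectralMeasure {W : Type w} [DecidableEq W] (H : SimpleGraph W) [H.LocallyFinite]
    {d : ℕ} (hd : H.IsRegularOfDegree d) (o : W) : Measure ℝ :=
  operatorSpectralMeasure (transitionOperator H hd) (lp.single 2 o (1 : ℂ))

/-- The spectral measure of the Laplacian of a regular graph at the vertex `o`. -/
def laplacianSpectralMeasure {W : Type w} [DecidableEq W] (H : SimpleGraph W) [H.LocallyFinite]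
    {d : ℕ} (hd : H.IsRegularOfDegree d) (o : W) : Measure ℝ :=
  operatorSpectralMeasure (laplacianOperator H hd) (lp.single 2 o (1 : ℂ))

/-! ### The two integrands and the two limit expressions -/

/-- `log {(1 + q u²) - (q + 1) u λ}` -/
def transitionLog (q : ℕ) (u : ℂ) (t : ℝ) : ℂ :=
  Complex.log ((1 + (q : ℂ) * u ^ 2) - ((q : ℂ) + 1) * u * (t : ℂ))

/-- `log {(1 + q u²) - (q + 1 - λ) u}` -/
def laplacianLog (q : ℕ) (u : ℂ) (t : ℝ) : ℂ :=
  Complex.log ((1 + (q : ℂ) * u ^ 2) - ((q : ℂ) + 1 - (t : ℂ)) * u)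

/-- `(1 - u²)^{(q-1)/2} exp [∫ log {(1 + q u²) - (q + 1) u λ} dμ(λ)]` -/
def transitionLimit (q : ℕ) (u : ℂ) (μ : Measure ℝ) : ℂ :=
  (1 - u ^ 2) ^ (((q : ℂ) - 1) / 2) * Complex.exp (∫ t, transitionLog q u t ∂μ)

/-- `(1 - u²)^{(q-1)/2} exp [∫ log {(1 + q u²) - (q + 1 - λ) u} dμ(λ)]` -/
def laplacianLimit (q : ℕ) (u : ℂ) (μ : Measure ℝ) : ℂ :=
  (1 - u ^ 2) ^ (((q : ℂ) - 1) / 2) * Complex.exp (∫ t, laplacianLog q u t ∂μ)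

end IharaLimit

end

open IharaLimit

namespace IharaLimit

open Polynomial

universe v w

/-! ### Dickson polynomials and the logarithm -/

/-! For a finite graph an exact formula holds before any limit. Let `B` be the Hashimoto matrix on
arcs. Then `tr B ^ m` counts reduced cycles over all base vertices, so by transitivity `N⁰ₘ = tr B ^
m / |V|`. Instead of the Ihara-Bass determinant, a recursion for traces
(`trace_hashimotoMatrix_pow`) gives `tr B ^ m = tr Dₘ(A) + |V| (q - 1) / 2 * (1 + (-1) ^ m)`. Here
`Dₘ` is the Dickson polynomial with `Dₘ(α + β) = α ^ m + β ^ m` when `α β = q`.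

Weighting by `u ^ m / m` and summing turns an eigenvalue `a = α + β` into `-log ((1 - α u) (1 - β
u)) = -log (1 + q u² - a u)`, and the parity term into `-(q - 1) / 2 * log (1 - u²)`. Since `|a| ≤ q
+ 1` forces `|α|, |β| ≤ q`, the condition `q |u| < 1` gives convergence and keeps the logarithm off
its cut. The integrand is thus bounded and continuous on the relevant interval, and weak convergence
passes to the limit. `P` and `Δ` are treated together: each is a matrix `M` with `A = L(M)` for a
linear polynomial `L`.

Under local convergence, short reduced cycles and closed walks at the base vertex are eventually
counted alike in `G n` and in the limit. Closed walks give the moments of the spectral measures;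
with uniformly bounded supports, Weierstrass approximation yields weak convergence. Reduced cycles
give convergence of the zeta series, dominated by `3 (q |u|) ^ m`. Uniqueness of limits then
identifies the formulas for the infinite graph. -/

theorem dickson_eval_add {R : Type*} [CommRing R] {α β q : R} (h : α * β = q) (m : ℕ) :
    (dickson 1 q m).eval (α + β) = α ^ m + β ^ m := by
  subst h
  induction m using Nat.twoStepInduction with
  | zero => simp [dickson_zero]; norm_num
  | one => simp
  | more m ih₀ ih₁ =>
    rw [dickson_add_two]
    simp only [eval_sub, eval_mul, eval_X, eval_C, ih₀, ih₁]
    ring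

theorem ofReal_dickson_eval (q : ℕ) (m : ℕ) (a : ℝ) :
    (((dickson 1 (q : ℝ) m).eval a : ℝ) : ℂ) = (dickson 1 (q : ℂ) m).eval (a : ℂ) := by
  have h : (dickson 1 (q : ℂ) m) = (dickson 1 (q : ℝ) m).map (algebraMap ℝ ℂ) := by
    rw [map_dickson]; simp
  rw [h, eval_map_algebraMap, ← Complex.coe_algebraMap, aeval_algebraMap_apply]
  simp

/-- The two roots of `z² - a z + q` for real `|a| ≤ q + 1` lie in the disc of radius `q`. -/
theorem exists_roots_norm_le {q : ℝ} (hq : 1 ≤ q) {a : ℝ} (ha : |a| ≤ q + 1) :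
    ∃ α β : ℂ, α + β = a ∧ α * β = q ∧ ‖α‖ ≤ q ∧ ‖β‖ ≤ q := by
  obtain ⟨ha₁, ha₂⟩ := abs_le.1 ha
  rcases le_total 0 (a ^ 2 - 4 * q) with h | h
  · set s := √(a ^ 2 - 4 * q)
    have hs : s ^ 2 = a ^ 2 - 4 * q := Real.sq_sqrt h
    have hs0 : 0 ≤ s := Real.sqrt_nonneg _
    -- Squared, this is `0 ≤ 4 * q * (q + 1 - a)`; the next bound is its mirror image.
    have h₁ : s ≤ 2 * q - a := by
      refine abs_le_of_sq_le_sq' ?_ (by linarith) |>.2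
      nlinarith
    have h₂ : s ≤ 2 * q + a := by
      refine abs_le_of_sq_le_sq' ?_ (by linarith) |>.2
      nlinarith
    refine ⟨((a + s) / 2 : ℝ), ((a - s) / 2 : ℝ), ?_, ?_, ?_, ?_⟩
    · push_cast; ring
    · rw [← Complex.ofReal_mul]; congr 1; nlinarith
    · rw [Complex.norm_real, Real.norm_eq_abs, abs_le]; constructor <;> linarith
    · rw [Complex.norm_real, Real.norm_eq_abs, abs_le]; constructor <;> linarith
  · set s := √(4 * q - a ^ 2)
    have hs : s ^ 2 = 4 * q - a ^ 2 := Real.sq_sqrt (by linarith)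
    -- Conjugate roots have squared modulus `q`, and `q ≤ q ^ 2`.
    have key : ∀ t : ℝ, t ^ 2 = s ^ 2 → ‖(⟨a / 2, t / 2⟩ : ℂ)‖ ≤ q := by
      intro t ht
      refine abs_le_of_sq_le_sq' ?_ (by linarith) |>.2
      rw [Complex.sq_norm, Complex.normSq_mk]
      nlinarith
    refine ⟨⟨a / 2, s / 2⟩, ⟨a / 2, -s / 2⟩, ?_, ?_, key _ rfl, key _ (by ring)⟩
    · apply Complex.ext <;> simp; ring
    · apply Complex.ext <;> simp
      · nlinarith
      · ring

/-- The growth rate `q` is attained: at `a = q + 1` the roots are `q` and `1`. This is the origin of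
the condition `q |u| < 1`. -/
theorem abs_dickson_eval_le {q : ℕ} (hq : 1 ≤ q) {a : ℝ} (ha : |a| ≤ q + 1) (m : ℕ) :
    |(dickson 1 (q : ℝ) m).eval a| ≤ 2 * (q : ℝ) ^ m := by
  obtain ⟨α, β, h₁, h₂, h₃, h₄⟩ := exists_roots_norm_le (q := q) (by exact_mod_cast hq) ha
  rw [← Real.norm_eq_abs, ← Complex.norm_real, ofReal_dickson_eval, ← h₁,
    dickson_eval_add (by simpa using h₂)]
  calc _ ≤ ‖α‖ ^ m + ‖β‖ ^ m := by
        refine (norm_add_le _ _).trans ?_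
        rw [norm_pow, norm_pow]
    _ ≤ (q : ℝ) ^ m + (q : ℝ) ^ m := by gcongr
    _ = _ := by ring

/-- Both factors lie in the open right half-plane, so their arguments add up to less than `π` in
absolute value and the principal logarithm is additive. -/
theorem one_sub_mem_slitPlane_mul {z w : ℂ} (hz : ‖z‖ < 1) (hw : ‖w‖ < 1) :
    (1 - z) * (1 - w) ∈ Complex.slitPlane ∧
      Complex.log ((1 - z) * (1 - w)) = Complex.log (1 - z) + Complex.log (1 - w) := by
  have pos : ∀ {z : ℂ}, ‖z‖ < 1 → 0 < (1 - z).re := fun {z} hz => by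
    have := (Complex.re_le_norm z).trans_lt hz
    simpa using this
  have ne : ∀ {z : ℂ}, ‖z‖ < 1 → 1 - z ≠ 0 := fun {z} hz h => by
    have := pos hz; simp [h] at this
  have arg : ∀ {z : ℂ}, ‖z‖ < 1 → |(1 - z).arg| < Real.pi / 2 := fun {z} hz =>
    Complex.abs_arg_lt_pi_div_two_iff.2 (Or.inl (pos hz))
  obtain ⟨h₁, h₂⟩ := abs_lt.1 (arg hz)
  obtain ⟨h₃, h₄⟩ := abs_lt.1 (arg hw)
  have hmem : (1 - z).arg + (1 - w).arg ∈ Set.Ioc (-Real.pi) Real.pi := ⟨by linarith, by linarith⟩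
  refine ⟨?_, Complex.log_mul (ne hz) (ne hw) hmem⟩
  rw [Complex.mem_slitPlane_iff_arg]
  refine ⟨?_, mul_ne_zero (ne hz) (ne hw)⟩
  rw [Complex.arg_mul (ne hz) (ne hw) hmem]
  intro h; linarith

theorem hasSum_neg_log_one_sub_mul {z w : ℂ} (hz : ‖z‖ < 1) (hw : ‖w‖ < 1) :
    HasSum (fun k : ℕ => (z ^ (k + 1) + w ^ (k + 1)) / ((k + 1 : ℕ) : ℂ))
      (-Complex.log ((1 - z) * (1 - w))) := by
  rw [(one_sub_mem_slitPlane_mul hz hw).2, neg_add]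
  convert (Complex.hasSum_taylorSeries_neg_log' hz).add (Complex.hasSum_taylorSeries_neg_log' hw)
    using 2
  push_cast; ring

variable {q : ℕ} {u : ℂ}

theorem norm_mul_lt_one {z : ℂ} (hu : (q : ℝ) * ‖u‖ < 1) (hz : ‖z‖ ≤ q) : ‖z * u‖ < 1 := by
  rw [norm_mul]
  exact (mul_le_mul_of_nonneg_right hz (norm_nonneg _)).trans_lt hu

theorem mem_slitPlane_quadratic (hq : 1 ≤ q) (hu : (q : ℝ) * ‖u‖ < 1) {a : ℝ}
    (ha : |a| ≤ q + 1) : 1 + q * u ^ 2 - u * a ∈ Complex.slitPlane := by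
  obtain ⟨α, β, h₁, h₂, h₃, h₄⟩ := exists_roots_norm_le (q := q) (by exact_mod_cast hq) ha
  have := (one_sub_mem_slitPlane_mul (norm_mul_lt_one hu h₃) (norm_mul_lt_one hu h₄)).1
  convert this using 1
  rw [← h₁, ← Complex.ofReal_natCast, ← h₂]
  ring

theorem hasSum_neg_log_quadratic (hq : 1 ≤ q) (hu : (q : ℝ) * ‖u‖ < 1) {a : ℝ}
    (ha : |a| ≤ q + 1) :
    HasSum (fun k : ℕ => (((dickson 1 (q : ℝ) (k + 1)).eval a : ℝ) : ℂ) / ((k + 1 : ℕ) : ℂ)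
      * u ^ (k + 1)) (-Complex.log (1 + q * u ^ 2 - u * a)) := by
  obtain ⟨α, β, h₁, h₂, h₃, h₄⟩ := exists_roots_norm_le (q := q) (by exact_mod_cast hq) ha
  have := hasSum_neg_log_one_sub_mul (norm_mul_lt_one hu h₃) (norm_mul_lt_one hu h₄)
  convert this using 2
  · rw [ofReal_dickson_eval, ← h₁, dickson_eval_add (by simpa using h₂)]
    ring
  · congr 1
    rw [← h₁, ← Complex.ofReal_natCast, ← h₂]
    ring

/-- This sums the parity term of the trace formula, via `1 - u² = (1 - u) (1 + u)`. -/
theorem hasSum_neg_log_one_sub_sq (hu : ‖u‖ < 1) :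
    HasSum (fun k : ℕ => (1 + (-1) ^ (k + 1)) / ((k + 1 : ℕ) : ℂ) * u ^ (k + 1))
      (-Complex.log (1 - u ^ 2)) := by
  have := hasSum_neg_log_one_sub_mul hu (w := -u) (by simpa using hu)
  convert this using 2
  · rw [neg_pow]; ring
  · congr 1; ring

/-! ### The non-backtracking matrix of a regular graph -/

section NonBacktracking

variable {V : Type*} [Fintype V] [DecidableEq V] (G : SimpleGraph V) [DecidableRel G.Adj]

/-- Incidence of vertices with the arcs that start there. -/
def startMatrix : Matrix V G.Dart ℝ := Matrix.of fun v e => if e.fst = v then 1 else 0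

/-- Incidence of arcs with the vertices where they end. -/
def endMatrix : Matrix G.Dart V ℝ := Matrix.of fun e v => if e.snd = v then 1 else 0

/-- The permutation matrix of arc reversal. -/
def flipMatrix : Matrix G.Dart G.Dart ℝ := Matrix.of fun e f => if f = e.symm then 1 else 0

/-- The non-backtracking (Hashimoto) matrix. -/
def hashimotoMatrix : Matrix G.Dart G.Dart ℝ :=
  Matrix.of fun e f => if e.snd = f.fst ∧ f.symm ≠ e then 1 else 0

theorem sum_dart {M : Type*} [AddCommMonoid M] (f : G.Dart → M) :
    ∑ e, f e = ∑ x, ∑ z : G.neighborSet x, f ⟨(x, z), z.2⟩ := by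
  rw [← Finset.sum_fiberwise Finset.univ (fun e : G.Dart => e.fst)]
  refine Finset.sum_congr rfl fun x _ => ?_
  refine Finset.sum_bij' (fun e he => ⟨e.snd, by
      rw [← (Finset.mem_filter.1 he).2]; exact e.adj⟩) (fun z _ => ⟨(x, z), z.2⟩) ?_ ?_ ?_ ?_ ?_
  · simp
  · simp
  · rintro ⟨⟨a, b⟩, h⟩ he
    obtain rfl : a = x := (Finset.mem_filter.1 he).2
    rfl
  · simp
  · rintro ⟨⟨a, b⟩, h⟩ he
    obtain rfl : a = x := (Finset.mem_filter.1 he).2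
    rfl

theorem startMatrix_mul_endMatrix : startMatrix G * endMatrix G = G.adjMatrix ℝ := by
  ext v w
  rw [Matrix.mul_apply, sum_dart, Finset.sum_eq_single v]
  · simp only [startMatrix, endMatrix, Matrix.of_apply, if_true, one_mul,
      SimpleGraph.adjMatrix_apply]
    by_cases h : G.Adj v w
    · rw [Finset.sum_eq_single ⟨w, h⟩] <;> simp [h]
      intro a ha hne h'
      exact absurd (Subtype.ext h') hne
    · rw [if_neg h]
      refine Finset.sum_eq_zero fun z _ => if_neg ?_
      rintro rfl
      exact h z.2
  · intro x _ hx
    simp [startMatrix, hx]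
  · simp

omit [DecidableRel G.Adj] in
-- Among the arcs that start where `e` ends, exactly one backtracks: the reversal of `e`.
theorem endMatrix_mul_startMatrix :
    endMatrix G * startMatrix G = hashimotoMatrix G + flipMatrix G := by
  ext e f
  simp only [Matrix.mul_apply, endMatrix, startMatrix, Matrix.of_apply, hashimotoMatrix,
    flipMatrix, Matrix.add_apply, ite_mul, one_mul, zero_mul, Finset.sum_ite_eq, Finset.mem_univ,
    if_true]
  by_cases h : f = e.symm
  · subst h; simp
  · have h' : f.symm ≠ e := fun h' => h (by rw [← h', SimpleGraph.Dart.symm_symm])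
    simp [h, h', eq_comm]

theorem startMatrix_mul_flipMatrix : startMatrix G * flipMatrix G = (endMatrix G).transpose := by
  ext v f
  simp only [Matrix.mul_apply, endMatrix, startMatrix, Matrix.of_apply, flipMatrix,
    Matrix.transpose_apply]
  rw [Finset.sum_eq_single f.symm]
  · simp
  · intro e _ he
    have : f ≠ e.symm := fun h => he (by rw [h, SimpleGraph.Dart.symm_symm])
    simp [this]
  · simp

theorem flipMatrix_mul_endMatrix : flipMatrix G * endMatrix G = (startMatrix G).transpose := by
  ext e v
  simp only [Matrix.mul_apply, endMatrix, startMatrix, Matrix.of_apply, flipMatrix,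
    Matrix.transpose_apply, ite_mul, one_mul, zero_mul, Finset.sum_ite_eq',
    Finset.mem_univ, if_true]
  simp

theorem flipMatrix_mul_self : flipMatrix G * flipMatrix G = 1 := by
  ext e f
  simp only [Matrix.mul_apply, Matrix.of_apply, flipMatrix, ite_mul, one_mul, zero_mul,
    Finset.sum_ite_eq', Finset.mem_univ, if_true, Matrix.one_apply,
    SimpleGraph.Dart.symm_symm, eq_comm]

variable {G} {q : ℕ}

theorem startMatrix_mul_transpose (hG : G.IsRegularOfDegree (q + 1)) :
    startMatrix G * (startMatrix G).transpose = ((q : ℝ) + 1) • 1 := by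
  ext v w
  rw [Matrix.mul_apply, sum_dart, Finset.sum_eq_single v]
  · by_cases h : v = w
    · subst h
      have := G.card_neighborFinset_eq_degree v
      rw [hG v, SimpleGraph.neighborFinset_eq_filter] at this
      simp [startMatrix, this]
    · simp [startMatrix, h]
  · intro x _ hx
    simp [startMatrix, hx]
  · simp

/-- Of the `q + 1` arcs that enter the start of a given arc, all but its reversal may precede it. -/
theorem endMatrix_transpose_mul_hashimotoMatrix (hG : G.IsRegularOfDegree (q + 1)) :
    (endMatrix G).transpose * hashimotoMatrix G = (q : ℝ) • startMatrix G := by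
  have h := eq_sub_of_add_eq (endMatrix_mul_startMatrix G).symm
  rw [h, Matrix.mul_sub, ← startMatrix_mul_flipMatrix, Matrix.mul_assoc _ (flipMatrix G),
    Matrix.mul_assoc _ (flipMatrix G), flipMatrix_mul_self, ← Matrix.mul_assoc (flipMatrix G),
    flipMatrix_mul_endMatrix, ← Matrix.mul_assoc, startMatrix_mul_transpose hG]
  simp [add_smul, Matrix.add_mul]

theorem startMatrix_mul_hashimotoMatrix :
    startMatrix G * hashimotoMatrix G
      = G.adjMatrix ℝ * startMatrix G - (endMatrix G).transpose := by
  have h := eq_sub_of_add_eq (endMatrix_mul_startMatrix G).symm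
  rw [h, Matrix.mul_sub, ← Matrix.mul_assoc, startMatrix_mul_endMatrix, startMatrix_mul_flipMatrix]

theorem endMatrix_transpose_mul_endMatrix (hG : G.IsRegularOfDegree (q + 1)) :
    (endMatrix G).transpose * endMatrix G = ((q : ℝ) + 1) • 1 := by
  rw [← startMatrix_mul_flipMatrix, Matrix.mul_assoc, flipMatrix_mul_endMatrix,
    startMatrix_mul_transpose hG]

variable (G) in
/-- The matrix that counts walks of length `k + 1` without backtracking. -/
def nonBacktrackingMatrix (k : ℕ) : Matrix V V ℝ :=
  startMatrix G * hashimotoMatrix G ^ k * endMatrix G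

theorem nonBacktrackingMatrix_zero : nonBacktrackingMatrix G 0 = G.adjMatrix ℝ := by
  simp [nonBacktrackingMatrix, startMatrix_mul_endMatrix]

/-- The exceptional step of the recursion: a walk of length two can backtrack along any of `q + 1`
edges, whereas later only `q` are available. -/
theorem nonBacktrackingMatrix_one (hG : G.IsRegularOfDegree (q + 1)) :
    nonBacktrackingMatrix G 1 = G.adjMatrix ℝ ^ 2 - ((q : ℝ) + 1) • 1 := by
  rw [nonBacktrackingMatrix, pow_one, startMatrix_mul_hashimotoMatrix, Matrix.sub_mul,
    Matrix.mul_assoc, startMatrix_mul_endMatrix, endMatrix_transpose_mul_endMatrix hG, sq]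

/-- A step is put in front of a non-backtracking walk. The bad cases go to a neighbour and straight
back, then follow a shorter walk; that neighbour is any of the `q` not visited by its first step. -/
theorem nonBacktrackingMatrix_add_two (hG : G.IsRegularOfDegree (q + 1)) (k : ℕ) :
    nonBacktrackingMatrix G (k + 2)
      = G.adjMatrix ℝ * nonBacktrackingMatrix G (k + 1) - (q : ℝ) • nonBacktrackingMatrix G k := by
  rw [nonBacktrackingMatrix, pow_succ', ← Matrix.mul_assoc, startMatrix_mul_hashimotoMatrix,
    Matrix.sub_mul, Matrix.sub_mul]
  congr 1
  · simp only [nonBacktrackingMatrix, Matrix.mul_assoc]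
  · rw [pow_succ', ← Matrix.mul_assoc, endMatrix_transpose_mul_hashimotoMatrix hG,
      nonBacktrackingMatrix]
    simp only [Matrix.smul_mul]

/-- Both sides solve `X (k + 2) = A * X (k + 1) - q • X k`, so agreement at `k = 0, 1` suffices. The
left side is the combination produced by the trace recursion below. -/
theorem nonBacktrackingMatrix_sub (hG : G.IsRegularOfDegree (q + 1)) (k : ℕ) :
    nonBacktrackingMatrix G (k + 2) - (q : ℝ) • nonBacktrackingMatrix G k
      = aeval (G.adjMatrix ℝ) (dickson 1 (q : ℝ) (k + 3))
        - aeval (G.adjMatrix ℝ) (dickson 1 (q : ℝ) (k + 1)) := by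
  set A := G.adjMatrix ℝ
  have hD : ∀ k, aeval A (dickson 1 (q : ℝ) (k + 2))
      = A * aeval A (dickson 1 (q : ℝ) (k + 1)) - (q : ℝ) • aeval A (dickson 1 (q : ℝ) k) := by
    intro k
    rw [dickson_add_two]
    simp [Algebra.smul_def]
  have hD0 : aeval A (dickson 1 (q : ℝ) 0) = 2 • (1 : Matrix V V ℝ) := by
    have : (3 - ((1 : ℕ) : ℝ[X])) = 2 • 1 := by norm_num
    rw [dickson_zero, this, map_nsmul, map_one]
  have hD1 : aeval A (dickson 1 (q : ℝ) 1) = A := by simp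
  induction k using Nat.twoStepInduction with
  | zero =>
    rw [hD, hD, zero_add, hD0, hD1, nonBacktrackingMatrix_add_two hG, zero_add,
      nonBacktrackingMatrix_one hG, nonBacktrackingMatrix_zero, sq]
    simp only [mul_sub, mul_smul_comm, mul_one]
    module
  | one =>
    rw [hD 2, hD 1, hD 0, zero_add, hD0, hD1, nonBacktrackingMatrix_add_two hG,
      nonBacktrackingMatrix_add_two hG, zero_add, nonBacktrackingMatrix_one hG,
      nonBacktrackingMatrix_zero, sq]
    simp only [mul_sub, mul_smul_comm, mul_one]
    module
  | more k ih₀ ih₁ =>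
    have e : ∀ k, nonBacktrackingMatrix G (k + 2) = A * nonBacktrackingMatrix G (k + 1)
        - (q : ℝ) • nonBacktrackingMatrix G k := nonBacktrackingMatrix_add_two hG
    have e' : nonBacktrackingMatrix G (k + 2 + 2) - (q : ℝ) • nonBacktrackingMatrix G (k + 2)
        = A * nonBacktrackingMatrix G (k + 3) - (q : ℝ) • nonBacktrackingMatrix G (k + 2)
          - (q : ℝ) • (A * nonBacktrackingMatrix G (k + 1)
            - (q : ℝ) • nonBacktrackingMatrix G k) := by
      rw [← e, ← e]
    rw [e']
    have : ∀ X₁ X₂ Y₁ Y₂ : Matrix V V ℝ, A * X₁ - (q : ℝ) • X₂ - (q : ℝ) • (A * Y₁ - (q : ℝ) • Y₂)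
        = A * (X₁ - (q : ℝ) • Y₁) - (q : ℝ) • (X₂ - (q : ℝ) • Y₂) := by
      intro X₁ X₂ Y₁ Y₂
      simp only [mul_sub, mul_smul_comm]
      module
    rw [this, ih₀, ih₁, hD (k + 3), hD (k + 1)]
    simp only [mul_sub]
    module

/-- With `S`, `E`, `J` the start, end and flip matrices, substitute `B = E S - J` twice and use `S J
= Eᵀ`, `J² = 1` and `Eᵀ B = q S`. Combinatorially, closed non-backtracking walks with a tail are
removed. -/
theorem trace_hashimotoMatrix_pow_add_three (hG : G.IsRegularOfDegree (q + 1)) (k : ℕ) :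
    (hashimotoMatrix G ^ (k + 3)).trace = (nonBacktrackingMatrix G (k + 2)).trace
      - q * (nonBacktrackingMatrix G k).trace + (hashimotoMatrix G ^ (k + 1)).trace := by
  have h := eq_sub_of_add_eq (endMatrix_mul_startMatrix G).symm
  set B := hashimotoMatrix G with hB
  have h₁ : (B ^ (k + 3)).trace
      = (nonBacktrackingMatrix G (k + 2)).trace - (B ^ (k + 2) * flipMatrix G).trace := by
    rw [pow_succ, show B ^ (k + 2) * B = B ^ (k + 2) * (endMatrix G * startMatrix G)
      - B ^ (k + 2) * flipMatrix G by rw [← mul_sub, ← h], Matrix.trace_sub, ← Matrix.mul_assoc,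
      Matrix.trace_mul_comm, nonBacktrackingMatrix, ← hB, Matrix.mul_assoc]
  have h₂ : (B ^ (k + 2) * flipMatrix G).trace
      = q * (nonBacktrackingMatrix G k).trace - (B ^ (k + 1)).trace := by
    have : B ^ (k + 2) * flipMatrix G
        = B ^ (k + 1) * endMatrix G * (endMatrix G).transpose - B ^ (k + 1) := by
      rw [pow_succ B (k + 1), show B ^ (k + 1) * B = B ^ (k + 1) * (endMatrix G * startMatrix G)
        - B ^ (k + 1) * flipMatrix G by rw [← mul_sub, ← h], sub_mul, mul_assoc _ (flipMatrix G),
        flipMatrix_mul_self, mul_one, ← startMatrix_mul_flipMatrix]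
      simp only [Matrix.mul_assoc]
    rw [this, Matrix.trace_sub, Matrix.trace_mul_comm, pow_succ', ← Matrix.mul_assoc,
      ← Matrix.mul_assoc, endMatrix_transpose_mul_hashimotoMatrix hG, nonBacktrackingMatrix]
    simp [Matrix.smul_mul, hB]
  rw [h₁, h₂]
  ring

theorem trace_hashimotoMatrix : (hashimotoMatrix G).trace = 0 := by
  refine Finset.sum_eq_zero fun e _ => if_neg fun h => ?_
  exact e.adj.ne h.1.symm

theorem trace_hashimotoMatrix_sq : (hashimotoMatrix G ^ 2).trace = 0 := by
  refine Finset.sum_eq_zero fun e _ => ?_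
  rw [Matrix.diag_apply, sq, Matrix.mul_apply]
  refine Finset.sum_eq_zero fun f _ => ?_
  by_contra hne
  simp only [hashimotoMatrix, Matrix.of_apply, mul_ite, mul_one, mul_zero, ite_eq_right_iff,
    Classical.not_imp] at hne
  obtain ⟨h₁, h₂, -⟩ := hne
  refine h₂.2 (SimpleGraph.Dart.ext _ _ (Prod.ext ?_ ?_))
  · exact h₁.1
  · exact h₂.1.symm

theorem trace_adjMatrix_sq (hG : G.IsRegularOfDegree (q + 1)) :
    (G.adjMatrix ℝ ^ 2).trace = Fintype.card V * ((q : ℝ) + 1) := by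
  have : ∀ v, (G.adjMatrix ℝ ^ 2) v v = (q : ℝ) + 1 := fun v => by
    rw [sq, SimpleGraph.adjMatrix_mul_self_apply_self, hG v]; simp
  simp only [Matrix.trace, Matrix.diag_apply, this, Finset.sum_const, Finset.card_univ,
    nsmul_eq_mul]

/-- The trace of powers of the non-backtracking matrix in terms of the adjacency matrix. -/
theorem trace_hashimotoMatrix_pow (hG : G.IsRegularOfDegree (q + 1)) (k : ℕ) :
    (hashimotoMatrix G ^ (k + 1)).trace
      = (aeval (G.adjMatrix ℝ) (dickson 1 (q : ℝ) (k + 1))).trace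
        + Fintype.card V * (((q : ℝ) - 1) / 2 * (1 + (-1) ^ (k + 1))) := by
  induction k using Nat.twoStepInduction with
  | zero => simp [trace_hashimotoMatrix]
  | one =>
    rw [trace_hashimotoMatrix_sq, dickson_two]
    have : (3 - ((1 : ℕ) : ℝ[X])) = 2 • 1 := by norm_num
    rw [this]
    simp only [map_sub, map_pow, aeval_X, map_mul, map_nsmul, map_one, Matrix.trace_sub,
      trace_adjMatrix_sq hG, aeval_C, Algebra.algebraMap_eq_smul_one, smul_mul_assoc, one_mul,
      Matrix.trace_smul, Matrix.trace_one]
    simp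
    ring
  | more k ih₀ ih₁ =>
    -- The parity term is the same at `k + 1` and `k + 3`, so only the Dickson traces have to match.
    have := congrArg Matrix.trace (nonBacktrackingMatrix_sub hG k)
    simp only [Matrix.trace_sub, Matrix.trace_smul, smul_eq_mul] at this
    rw [show k + 2 + 1 = k + 3 from rfl, trace_hashimotoMatrix_pow_add_three hG k, ih₀]
    linear_combination this

end NonBacktracking

/-! ### Counting walks -/

section Walks

variable {V : Type v} {W : Type w}

/-- The number of walks of length `m` between two vertices. -/
noncomputable def numWalks (G : SimpleGraph V) (x y : V) (m : ℕ) : ℕ :=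
  Set.ncard {p : G.Walk x y | p.length = m}

theorem finite_walks_length (G : SimpleGraph V) [G.LocallyFinite] (x y : V) (m : ℕ) :
    {p : G.Walk x y | p.length = m}.Finite := by
  classical
  rw [← SimpleGraph.coe_finsetWalkLength_eq]
  exact Finset.finite_toSet _

/-- First-step decomposition. The predicate `Q` lets it serve plain walks, reduced cycles and the
entries of powers of `B` alike. -/
theorem ncard_walks_succ (G : SimpleGraph V) [G.LocallyFinite] (x y : V) (m : ℕ)
    (Q : G.Walk x y → Prop) :
    Set.ncard {p : G.Walk x y | p.length = m + 1 ∧ Q p}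
      = ∑ z : G.neighborSet x,
        Set.ncard {p : G.Walk (z : V) y | p.length = m ∧
          Q (.cons ((G.mem_neighborSet x z).1 z.2) p)} := by
  have hfin : ∀ z : G.neighborSet x,
      Finite {p : G.Walk (z : V) y | p.length = m ∧
        Q (.cons ((G.mem_neighborSet x z).1 z.2) p)} := fun z =>
    (finite_walks_length G z y m).subset fun p hp => hp.1
  simp only [← Nat.card_coe_set_eq]
  rw [← Nat.card_sigma]
  symm
  refine Nat.card_congr (Equiv.ofBijective
    (fun a => ⟨.cons ((G.mem_neighborSet x a.1).1 a.1.2) a.2.1, by simpa using a.2.2.1,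
      a.2.2.2⟩) ⟨?_, ?_⟩)
  · rintro ⟨⟨z, hz⟩, p, hp⟩ ⟨⟨z', hz'⟩, p', hp'⟩ h
    have h' := congrArg Subtype.val h
    simp only [SimpleGraph.Walk.cons.injEq] at h'
    obtain ⟨rfl, h'⟩ := h'
    obtain rfl := eq_of_heq h'
    rfl
  · rintro ⟨p, hp, hQ⟩
    cases p with
    | nil => simp at hp
    | cons h p => exact ⟨⟨⟨_, h⟩, p, by simpa using hp, hQ⟩, rfl⟩

theorem numWalks_zero_self (G : SimpleGraph V) (x : V) : numWalks G x x 0 = 1 := by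
  rw [numWalks, Set.ncard_eq_one]
  exact ⟨.nil, by ext p; simp [SimpleGraph.Walk.eq_nil_iff_nil]⟩

theorem numWalks_zero_of_ne (G : SimpleGraph V) {x y : V} (h : x ≠ y) : numWalks G x y 0 = 0 := by
  have : {p : G.Walk x y | p.length = 0} = ∅ := by
    ext p
    simp only [Set.mem_ofPred_eq, Set.mem_empty_iff_false, iff_false]
    exact fun hp => h (SimpleGraph.Walk.eq_of_length_eq_zero hp)
  rw [numWalks, this, Set.ncard_empty]

theorem numWalks_succ (G : SimpleGraph V) [G.LocallyFinite] (x y : V) (m : ℕ) :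
    numWalks G x y (m + 1) = ∑ z ∈ G.neighborFinset x, numWalks G z y m := by
  have := ncard_walks_succ G x y m (fun _ => True)
  simp only [and_true] at this
  rw [numWalks, this]
  exact (Finset.sum_subtype (G.neighborFinset x) (p := fun z => z ∈ G.neighborSet x) (by simp)
    (fun z => numWalks G z y m)).symm

/-- The only junction of `C ^ 2` absent from `C` is the last arc followed by the first, so repeating
the first arc at the end captures both conditions. This is the form of a diagonal entry of a power
of `B`. -/
theorem isReducedCycle_cons_iff (G : SimpleGraph V) {x z : V} (h : G.Adj x z) (p : G.Walk z x) :
    IsReducedCycle (.cons h p) ↔ List.IsChain (fun e f : G.Dart => f.symm ≠ e)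
      (⟨(x, z), h⟩ :: p.darts ++ [⟨(x, z), h⟩]) := by
  simp only [IsReducedCycle, NoBacktracking, SimpleGraph.Walk.darts_append,
    SimpleGraph.Walk.darts_cons]
  generalize (⟨(x, z), h⟩ : G.Dart) = e
  rw [List.isChain_append (l₂ := e :: p.darts), List.isChain_append (l₂ := [e])]
  simp

theorem isReducedCycle_map_iff {G : SimpleGraph V} {H : SimpleGraph W} {f : G →g H}
    (hf : Function.Injective f) {x : V} (p : G.Walk x x) :
    IsReducedCycle (p.map f) ↔ IsReducedCycle p := by
  have key : ∀ l : List G.Dart, List.IsChain (fun e f : H.Dart => f.symm ≠ e) (l.map f.mapDart)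
      ↔ List.IsChain (fun e f : G.Dart => f.symm ≠ e) l := by
    intro l
    rw [List.isChain_map]
    have : ∀ a b : G.Dart, (f.mapDart b).symm ≠ f.mapDart a ↔ b.symm ≠ a := by
      intro a b
      rw [not_iff_not, SimpleGraph.Dart.ext_iff, SimpleGraph.Dart.ext_iff, Prod.ext_iff,
        Prod.ext_iff]
      exact and_congr hf.eq_iff hf.eq_iff
    simp only [this]
  simp only [IsReducedCycle, NoBacktracking, ← SimpleGraph.Walk.map_append,
    SimpleGraph.Walk.darts_map, key]

/-- Closed walks that stay in `S` are transported injectively by an injective homomorphism defined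
on the subgraph induced by `S`. -/
theorem exists_closedWalk_injection {G : SimpleGraph V} {H : SimpleGraph W} {S : Set V} {x : V}
    (hx : x ∈ S) {m : ℕ} (hS : ∀ p : G.Walk x x, p.length = m → ∀ v ∈ p.support, v ∈ S)
    (χ : G.induce S →g H) (hχ : Function.Injective χ) {o : W} (ho : χ ⟨x, hx⟩ = o) :
    ∃ F : {p : G.Walk x x // p.length = m} → H.Walk o o, Function.Injective F ∧
      ∀ p, (F p).length = m ∧ (IsReducedCycle (F p) ↔ IsReducedCycle p.1) := by
  subst ho
  have hmap : ∀ (p : G.Walk x x) (hp : ∀ v ∈ p.support, v ∈ S),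
      (p.induce S hp).length = p.length := by
    intro p hp
    rw [← SimpleGraph.Walk.length_map (SimpleGraph.Embedding.induce S).toHom]
    exact congrArg SimpleGraph.Walk.length (SimpleGraph.Walk.map_induce p hp)
  refine ⟨fun p => (p.1.induce S (hS p.1 p.2)).map χ, fun p p' h => ?_, fun p => ⟨?_, ?_⟩⟩
  · have := SimpleGraph.Walk.map_injective_of_injective hχ _ _ h
    have := congrArg (SimpleGraph.Walk.map (SimpleGraph.Embedding.induce S).toHom) this
    rw [SimpleGraph.Walk.map_induce, SimpleGraph.Walk.map_induce] at this
    exact Subtype.ext this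
  · rw [SimpleGraph.Walk.length_map]
    exact (hmap p.1 _).trans p.2
  · rw [isReducedCycle_map_iff hχ]
    have := isReducedCycle_map_iff (f := (SimpleGraph.Embedding.induce (G := G) S).toHom)
      Subtype.val_injective (p.1.induce S (hS p.1 p.2))
    rw [← this]
    exact iff_of_eq (congrArg IsReducedCycle (SimpleGraph.Walk.map_induce p.1 (hS p.1 p.2)))

/-- Used in both directions to get equalities: with `S` the whole vertex set for automorphisms, and
with `S` a ball for local isomorphisms. -/
theorem numReducedCycles_le_and_numWalks_le {G : SimpleGraph V} {H : SimpleGraph W}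
    [H.LocallyFinite] {S : Set V} {x : V}
    (hx : x ∈ S) {m : ℕ} (hS : ∀ p : G.Walk x x, p.length = m → ∀ v ∈ p.support, v ∈ S)
    (χ : G.induce S →g H) (hχ : Function.Injective χ) {o : W} (ho : χ ⟨x, hx⟩ = o) :
    numReducedCycles G x m ≤ numReducedCycles H o m ∧ numWalks G x x m ≤ numWalks H o o m := by
  obtain ⟨F, hF, hF'⟩ := exists_closedWalk_injection hx hS χ hχ ho
  have hfin : Finite {p : H.Walk o o | p.length = m} := finite_walks_length H o o m
  have hfin' : Finite {p : H.Walk o o | p.length = m ∧ IsReducedCycle p} :=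
    (finite_walks_length H o o m).subset fun p hp => hp.1
  constructor
  · rw [numReducedCycles, numReducedCycles, ← Nat.card_coe_set_eq, ← Nat.card_coe_set_eq]
    refine Nat.card_le_card_of_injective
      (fun p => ⟨F ⟨p.1, p.2.1⟩, (hF' _).1, (hF' _).2.2 p.2.2⟩) fun p p' h => ?_
    have := Subtype.ext_iff.1 (hF (congrArg Subtype.val h))
    exact Subtype.ext this
  · rw [numWalks, numWalks, ← Nat.card_coe_set_eq, ← Nat.card_coe_set_eq]
    refine Nat.card_le_card_of_injective (fun p => ⟨F p, (hF' _).1⟩) fun p p' h => ?_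
    exact hF (congrArg Subtype.val h)

theorem mem_closedBall_of_mem_support {G : SimpleGraph V} {x y : V} {m : ℕ} (p : G.Walk x y)
    (hp : p.length ≤ m) {v : V} (hv : v ∈ p.support) : v ∈ closedBall G x m := by
  classical
  refine (SimpleGraph.edist_le (p.takeUntil v hv)).trans ?_
  exact_mod_cast (p.length_takeUntil_le_length hv).trans hp

theorem self_mem_closedBall (G : SimpleGraph V) (x : V) (r : ℕ) : x ∈ closedBall G x r := by
  simp [closedBall]

theorem numReducedCycles_eq_and_numWalks_eq_of_closedBall_iso {G : SimpleGraph V}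
    {H : SimpleGraph W} [G.LocallyFinite] [H.LocallyFinite] {x : V} {o : W} {r m : ℕ} (hm : m ≤ r)
    (φ : G.induce (closedBall G x r) ≃g H.induce (closedBall H o r))
    (hφ : ∀ y : closedBall G x r, (y : V) = x → (φ y : W) = o) :
    numReducedCycles G x m = numReducedCycles H o m ∧ numWalks G x x m = numWalks H o o m := by
  have hx := self_mem_closedBall G x r
  have ho := self_mem_closedBall H o r
  have h₁ : φ ⟨x, hx⟩ = ⟨o, ho⟩ := Subtype.ext (hφ _ rfl)
  have h₂ : φ.symm ⟨o, ho⟩ = ⟨x, hx⟩ := by rw [← h₁]; simp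
  have a := numReducedCycles_le_and_numWalks_le (m := m) hx
    (fun p hp v hv => mem_closedBall_of_mem_support p (hp.trans_le hm) hv)
    ((SimpleGraph.Embedding.induce _).toHom.comp φ.toEmbedding.toHom)
    (Subtype.val_injective.comp φ.injective) (o := o) (congrArg Subtype.val h₁)
  have b := numReducedCycles_le_and_numWalks_le (m := m) ho
    (fun p hp v hv => mem_closedBall_of_mem_support p (hp.trans_le hm) hv)
    ((SimpleGraph.Embedding.induce _).toHom.comp φ.symm.toEmbedding.toHom)
    (Subtype.val_injective.comp φ.symm.injective) (o := x) (congrArg Subtype.val h₂)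
  exact ⟨le_antisymm a.1 b.1, le_antisymm a.2 b.2⟩

theorem VertexTransitive.numReducedCycles_eq_and_numWalks_eq {G : SimpleGraph V} [G.LocallyFinite]
    (hG : VertexTransitive G) (x y : V) (m : ℕ) :
    numReducedCycles G x m = numReducedCycles G y m ∧ numWalks G x x m = numWalks G y y m := by
  have key : ∀ x y : V,
      numReducedCycles G x m ≤ numReducedCycles G y m ∧ numWalks G x x m ≤ numWalks G y y m := by
    intro x y
    obtain ⟨φ, hφ⟩ := hG x y
    exact numReducedCycles_le_and_numWalks_le (Set.mem_univ x) (fun _ _ _ _ => Set.mem_univ _)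
      (φ.toEmbedding.toHom.comp (SimpleGraph.Embedding.induce _).toHom)
      (φ.injective.comp Subtype.val_injective) hφ
  exact ⟨le_antisymm (key x y).1 (key y x).1, le_antisymm (key x y).2 (key y x).2⟩

end Walks

/-! ### Cycle and walk counts of finite graphs as traces -/

section FiniteGraphs

variable {V : Type v} [Fintype V] [DecidableEq V] {G : SimpleGraph V} [DecidableRel G.Adj]

/-- The walk `p` is the part strictly between `e` and `g`, hence length `m` for the power `m + 1`.
Induction peels off the first arc of `p`. -/
theorem hashimotoMatrix_pow_apply (m : ℕ) (e g : G.Dart) :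
    (hashimotoMatrix G ^ (m + 1)) e g = Set.ncard {p : G.Walk e.snd g.fst | p.length = m ∧
      List.IsChain (fun e f : G.Dart => f.symm ≠ e) (e :: p.darts ++ [g])} := by
  induction m generalizing e with
  | zero =>
    obtain ⟨⟨a, b⟩, hab⟩ := e
    obtain ⟨⟨c, d⟩, hcd⟩ := g
    simp only [zero_add, pow_one, hashimotoMatrix, Matrix.of_apply]
    change G.Adj a b at hab
    change G.Adj c d at hcd
    by_cases hbc : b = c
    · subst hbc
      by_cases h : SimpleGraph.Dart.symm ⟨(b, d), hcd⟩ ≠ (⟨(a, b), hab⟩ : G.Dart)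
      · rw [if_pos ⟨rfl, h⟩, Set.ncard_eq_one.2 ⟨.nil, ?_⟩, Nat.cast_one]
        ext p
        simp only [Set.mem_ofPred_eq, Set.mem_singleton_iff]
        constructor
        · exact fun hp => SimpleGraph.Walk.eq_nil_iff_nil.2 (by simpa using hp.1)
        · rintro rfl
          simpa using h
      · rw [if_neg (fun h' => h h'.2), eq_comm, Nat.cast_eq_zero]
        convert Set.ncard_empty (G.Walk b b)
        ext p
        simp only [Set.mem_ofPred_eq, Set.mem_empty_iff_false, iff_false, not_and]
        intro hp
        obtain rfl := (SimpleGraph.Walk.eq_nil_iff_nil (p := p)).2 (by simpa using hp)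
        simpa using h
    · rw [if_neg (fun h' => hbc h'.1), eq_comm, Nat.cast_eq_zero]
      convert Set.ncard_empty (G.Walk b c)
      ext p
      simp only [Set.mem_ofPred_eq, Set.mem_empty_iff_false, iff_false, not_and]
      exact fun hp => absurd (SimpleGraph.Walk.eq_of_length_eq_zero hp) hbc
  | succ m ih =>
    rw [pow_succ', Matrix.mul_apply, sum_dart, Finset.sum_eq_single e.snd,
      ncard_walks_succ, Nat.cast_sum]
    · refine Finset.sum_congr rfl fun z _ => ?_
      rw [ih]
      simp only [hashimotoMatrix, Matrix.of_apply, SimpleGraph.Walk.darts_cons, List.cons_append,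
        List.isChain_cons_cons, true_and]
      split_ifs with h
      · simp only [ne_eq, h, not_false_eq_true, one_mul, true_and]
      · simp only [h, zero_mul, false_and, and_false]
        simp
    · intro x _ hx
      simp [hashimotoMatrix, hx.symm]
    · simp

/-- The diagonal entry at an arc counts the reduced cycles beginning with it; arcs are then grouped
by starting vertex. -/
theorem trace_hashimotoMatrix_pow_eq_sum (m : ℕ) :
    (hashimotoMatrix G ^ (m + 1)).trace = ∑ x, (numReducedCycles G x (m + 1) : ℝ) := by
  simp only [Matrix.trace, Matrix.diag_apply, hashimotoMatrix_pow_apply]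
  rw [sum_dart]
  refine Finset.sum_congr rfl fun x _ => ?_
  rw [numReducedCycles, ncard_walks_succ, Nat.cast_sum]
  simp only [isReducedCycle_cons_iff]

/-- The number of reduced cycles of a finite vertex-transitive graph as a normalized trace. -/
theorem numReducedCycles_eq_trace {q : ℕ} (hG : G.IsRegularOfDegree (q + 1))
    (htrans : VertexTransitive G) (x : V) (k : ℕ) :
    (numReducedCycles G x (k + 1) : ℝ)
      = (Fintype.card V : ℝ)⁻¹ * (aeval (G.adjMatrix ℝ) (dickson 1 (q : ℝ) (k + 1))).trace
        + ((q : ℝ) - 1) / 2 * (1 + (-1) ^ (k + 1)) := by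
  have h := trace_hashimotoMatrix_pow hG k
  rw [trace_hashimotoMatrix_pow_eq_sum] at h
  simp only [fun y => (htrans.numReducedCycles_eq_and_numWalks_eq y x (k + 1)).1,
    Finset.sum_const, Finset.card_univ, nsmul_eq_mul] at h
  have : Nonempty V := ⟨x⟩
  have hV : (Fintype.card V : ℝ) ≠ 0 := by positivity
  field_simp
  linear_combination 2 * h

/-- By transitivity the diagonal of each power of `A` is constant, so the normalized trace depends
only on closed walks at the base vertex, a local quantity. -/
theorem trace_aeval_adjMatrix (htrans : VertexTransitive G) (x : V) (p : ℝ[X]) :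
    (Fintype.card V : ℝ)⁻¹ * (aeval (G.adjMatrix ℝ) p).trace
      = p.sum fun k c => c * numWalks G x x k := by
  have : Nonempty V := ⟨x⟩
  have hV : (Fintype.card V : ℝ) ≠ 0 := by positivity
  have hpow : ∀ k, (G.adjMatrix ℝ ^ k).trace = Fintype.card V * numWalks G x x k := by
    intro k
    simp only [Matrix.trace, Matrix.diag_apply, SimpleGraph.adjMatrix_pow_apply_eq_card_walk]
    have : ∀ y, Fintype.card {p : G.Walk y y | p.length = k} = numWalks G x x k := fun y => by
      rw [(htrans.numReducedCycles_eq_and_numWalks_eq x y k).2, numWalks, ← Nat.card_coe_set_eq,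
        Nat.card_eq_fintype_card]
    rw [Finset.sum_congr rfl fun y _ => congrArg Nat.cast (this y)]
    simp
  rw [aeval_eq_sum_range, Matrix.trace_sum, Finset.mul_sum,
    sum_over_range _ (by simp)]
  refine Finset.sum_congr rfl fun k _ => ?_
  rw [Matrix.trace_smul, hpow, smul_eq_mul]
  field_simp

end FiniteGraphs

/-! ### Normalized spectral measures of symmetric matrices -/

section FiniteSpectralMeasure

variable {V : Type v} [Fintype V] [DecidableEq V] {M : Matrix V V ℝ}

theorem spectralMeasure_eq_sum (hM : M.IsHermitian) :
    spectralMeasure M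
      = (Fintype.card V : ℝ≥0∞)⁻¹ • ∑ i, Measure.dirac (hM.eigenvalues i) := by
  rw [spectralMeasure, hM.roots_charpoly_eq_eigenvalues, Multiset.map_map]
  rfl

theorem isProbabilityMeasure_spectralMeasure [Nonempty V] (hM : M.IsHermitian) :
    IsProbabilityMeasure (spectralMeasure M) := by
  refine ⟨?_⟩
  rw [spectralMeasure_eq_sum hM]
  simp only [Measure.smul_apply, Measure.coe_finsetSum, Finset.sum_apply, measure_univ,
    Finset.sum_const, Finset.card_univ, nsmul_eq_mul, mul_one, smul_eq_mul]
  exact ENNReal.inv_mul_cancel (by simp) (by simp)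

theorem ae_spectralMeasure (hM : M.IsHermitian) {Q : ℝ → Prop}
    (hQ : ∀ i, Q (hM.eigenvalues i)) : ∀ᵐ t ∂(spectralMeasure M), Q t := by
  rw [spectralMeasure_eq_sum hM]
  refine Measure.ae_smul_measure ?_ _
  rw [← Measure.sum_fintype, Measure.ae_sum_iff]
  intro i
  rw [ae_dirac_eq]
  exact hQ i

theorem integral_spectralMeasure (hM : M.IsHermitian) (f : ℝ → ℝ) :
    ∫ t, f t ∂(spectralMeasure M) = (Fintype.card V : ℝ)⁻¹ * ∑ i, f (hM.eigenvalues i) := by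
  rw [spectralMeasure_eq_sum hM, integral_smul_measure,
    integral_finsetSum_measure fun i _ => integrable_dirac (by simp)]
  simp

theorem trace_aeval (hM : M.IsHermitian) (p : ℝ[X]) :
    (aeval M p).trace = ∑ i, p.eval (hM.eigenvalues i) := by
  have hd : aeval (Matrix.diagonal hM.eigenvalues) p
      = Matrix.diagonal fun i => p.eval (hM.eigenvalues i) := by
    have := aeval_algHom_apply (Matrix.diagonalAlgHom ℝ (n := V) (α := ℝ)) hM.eigenvalues p
    rw [aeval_pi_apply] at this
    simpa using this
  have h : aeval M p = (hM.eigenvectorUnitary : Matrix V V ℝ)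
      * aeval (Matrix.diagonal hM.eigenvalues) p
      * star (hM.eigenvectorUnitary : Matrix V V ℝ) := by
    conv_lhs => rw [hM.spectral_theorem]
    rw [aeval_algHom_apply, Unitary.conjStarAlgAut_apply]
    rfl
  rw [h, Matrix.trace_mul_cycle, Unitary.coe_star_mul_self, one_mul, hd, Matrix.trace_diagonal]

theorem integral_eval_spectralMeasure (hM : M.IsHermitian) (p : ℝ[X]) :
    ∫ t, p.eval t ∂(spectralMeasure M) = (Fintype.card V : ℝ)⁻¹ * (aeval M p).trace := by
  rw [integral_spectralMeasure hM (fun t => p.eval t), trace_aeval hM]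

/-- Gershgorin's circle theorem. -/
theorem exists_abs_eigenvalue_sub_le (hM : M.IsHermitian) (i : V) :
    ∃ k, |hM.eigenvalues i - M k k| ≤ ∑ j ∈ Finset.univ.erase k, |M k j| := by
  have h : Module.End.HasEigenvalue (Matrix.toLin' M) (hM.eigenvalues i) := by
    rw [Module.End.hasEigenvalue_iff_mem_spectrum, Matrix.spectrum_toLin']
    exact hM.eigenvalues_mem_spectrum_real i
  obtain ⟨k, hk⟩ := eigenvalue_mem_ball h
  exact ⟨k, by simpa [Metric.mem_closedBall, Real.dist_eq] using hk⟩

end FiniteSpectralMeasure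

/-! ### Weak convergence of measures with bounded support -/

theorem integrable_of_ae_mem_Icc {μ : Measure ℝ} [IsFiniteMeasure μ] {a b : ℝ}
    (hμ : ∀ᵐ t ∂μ, t ∈ Set.Icc a b) {f : ℝ → ℝ} (hf : Continuous f) : Integrable f μ := by
  obtain ⟨C, hC⟩ := isCompact_Icc.exists_bound_of_continuousOn (f := f) (s := Set.Icc a b)
    hf.continuousOn
  exact Integrable.of_bound hf.aestronglyMeasurable C (hμ.mono hC)

/-- On the common compact interval Weierstrass approximation replaces a test function by a
polynomial, at a cost of `ε / 3` for each measure. -/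
theorem weaklyConverges_of_tendsto_integral_eval {μs : ℕ → Measure ℝ} {μ : Measure ℝ}
    [∀ n, IsProbabilityMeasure (μs n)] [IsProbabilityMeasure μ] {R : ℝ}
    (hμs : ∀ n, ∀ᵐ t ∂(μs n), t ∈ Set.Icc (-R) R) (hμ : ∀ᵐ t ∂μ, t ∈ Set.Icc (-R) R)
    (h : ∀ p : ℝ[X], Tendsto (fun n => ∫ t, p.eval t ∂(μs n)) atTop (𝓝 (∫ t, p.eval t ∂μ))) :
    WeaklyConverges μs μ := by
  intro f
  rw [Metric.tendsto_atTop]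
  intro ε hε
  obtain ⟨p, hp⟩ := exists_polynomial_near_of_continuousOn (-R) R f f.continuous.continuousOn
    (ε / 3) (by positivity)
  have key : ∀ (ν : Measure ℝ) [IsProbabilityMeasure ν], (∀ᵐ t ∂ν, t ∈ Set.Icc (-R) R) →
      |∫ t, p.eval t ∂ν - ∫ t, f t ∂ν| ≤ ε / 3 := by
    intro ν _ hν
    rw [← integral_sub (integrable_of_ae_mem_Icc hν p.continuous)
      (integrable_of_ae_mem_Icc hν f.continuous)]
    have := norm_integral_le_of_norm_le_const (μ := ν) (C := ε / 3)
      (f := fun t => p.eval t - f t) (hν.mono fun t ht => (hp t ht).le)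
    simpa using this
  obtain ⟨N, hN⟩ := Metric.tendsto_atTop.1 (h p) (ε / 3) (by positivity)
  refine ⟨N, fun n hn => ?_⟩
  have h₁ := abs_le.1 (key (μs n) (hμs n))
  have h₂ := abs_le.1 (key μ hμ)
  have h₃ := hN n hn
  rw [Real.dist_eq] at h₃ ⊢
  have h₃ := abs_lt.1 h₃
  rw [abs_lt]
  constructor <;> linarith [h₁.1, h₁.2, h₂.1, h₂.2, h₃.1, h₃.2]

/-- A closed condition that holds almost surely along a weakly convergent sequence holds almost
surely in the limit. -/
theorem WeaklyConverges.ae_abs_le {μs : ℕ → Measure ℝ} {μ : Measure ℝ} [IsProbabilityMeasure μ]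
    (h : WeaklyConverges μs μ) {ℓ : ℝ → ℝ} (hℓ : Continuous ℓ) {R : ℝ}
    (hμs : ∀ n, ∀ᵐ t ∂(μs n), |ℓ t| ≤ R) : ∀ᵐ t ∂μ, |ℓ t| ≤ R := by
  -- A bounded continuous test function that vanishes exactly where `|ℓ t| ≤ R`.
  set g : ℝ → ℝ := fun t => min 1 (max 0 (|ℓ t| - R)) with hg
  have hgc : Continuous g := by fun_prop
  have hg0 : ∀ t, 0 ≤ g t := fun t => le_min zero_le_one (le_max_left _ _)
  have hg1 : ∀ t, ‖g t‖ ≤ 1 := fun t => by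
    rw [Real.norm_of_nonneg (hg0 t)]; exact min_le_left _ _
  have hlim := h (BoundedContinuousFunction.ofNormedAddCommGroup g hgc 1 hg1)
  simp only [BoundedContinuousFunction.coe_ofNormedAddCommGroup] at hlim
  have hz : ∀ n, ∫ t, g t ∂(μs n) = 0 := fun n => by
    refine integral_eq_zero_of_ae ((hμs n).mono fun t ht => ?_)
    have : max 0 (|ℓ t| - R) = 0 := max_eq_left (by linarith)
    simp [hg, this]
  simp only [hz] at hlim
  have h0 : ∫ t, g t ∂μ = 0 := (tendsto_nhds_unique hlim tendsto_const_nhds)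
  rw [integral_eq_zero_iff_of_nonneg hg0
    (Integrable.of_bound hgc.aestronglyMeasurable 1 (Eventually.of_forall hg1))] at h0
  filter_upwards [h0] with t ht
  by_contra hlt
  have h1 : 0 < g t := lt_min one_pos (lt_max_of_lt_right (by linarith))
  exact h1.ne' ht

/-! ### The logarithmic integral -/

section LogIntegral

variable {q : ℕ} {u : ℂ} {μ : Measure ℝ} {ℓ : ℝ → ℝ}

/-- The common form of the integrands: `log (1 + q u² - u a)`. -/
noncomputable def quadraticLog (q : ℕ) (u : ℂ) (a : ℝ) : ℂ :=
  Complex.log (1 + q * u ^ 2 - u * a)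

theorem summable_bound (hu : (q : ℝ) * ‖u‖ < 1) :
    Summable fun k : ℕ => 2 * ((q : ℝ) * ‖u‖) ^ (k + 1) :=
  ((summable_nat_add_iff 1).2 (summable_geometric_of_lt_one (by positivity) hu)).mul_left 2

theorem norm_term_le (hq : 1 ≤ q) {a : ℝ} (ha : |a| ≤ q + 1) (k : ℕ) :
    ‖(((dickson 1 (q : ℝ) (k + 1)).eval a : ℝ) : ℂ) / ((k + 1 : ℕ) : ℂ) * u ^ (k + 1)‖
      ≤ 2 * ((q : ℝ) * ‖u‖) ^ (k + 1) := by
  rw [norm_mul, norm_div, Complex.norm_real, norm_pow, Complex.norm_natCast, Real.norm_eq_abs,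
    mul_pow, ← mul_assoc]
  refine mul_le_mul_of_nonneg_right ?_ (by positivity)
  refine (div_le_self (abs_nonneg _) ?_).trans (abs_dickson_eval_le hq ha _)
  exact_mod_cast Nat.le_add_left 1 k

theorem measurable_quadraticLog (hℓ : Continuous ℓ) :
    Measurable fun t => quadraticLog q u (ℓ t) := by
  refine Complex.measurable_log.comp ?_
  have := hℓ.measurable
  fun_prop

theorem integrable_quadraticLog [IsFiniteMeasure μ] (hq : 1 ≤ q) (hu : (q : ℝ) * ‖u‖ < 1)
    (hℓ : Continuous ℓ) (hμ : ∀ᵐ t ∂μ, |ℓ t| ≤ q + 1) :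
    Integrable (fun t => quadraticLog q u (ℓ t)) μ := by
  refine Integrable.of_bound (measurable_quadraticLog hℓ).aestronglyMeasurable
    (∑' k : ℕ, 2 * ((q : ℝ) * ‖u‖) ^ (k + 1)) (hμ.mono fun t ht => ?_)
  have h := hasSum_neg_log_quadratic hq hu ht
  rw [quadraticLog, ← norm_neg, ← h.tsum_eq]
  exact tsum_of_norm_bounded (summable_bound hu).hasSum fun k => norm_term_le hq ht k

theorem hasSum_integral_quadraticLog [IsFiniteMeasure μ] (hq : 1 ≤ q)
    (hu : (q : ℝ) * ‖u‖ < 1) (hℓ : Continuous ℓ) (hμ : ∀ᵐ t ∂μ, |ℓ t| ≤ q + 1) :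
    HasSum (fun k : ℕ => ((∫ t, (dickson 1 (q : ℝ) (k + 1)).eval (ℓ t) ∂μ : ℝ) : ℂ)
      / ((k + 1 : ℕ) : ℂ) * u ^ (k + 1)) (-∫ t, quadraticLog q u (ℓ t) ∂μ) := by
  rw [← integral_neg]
  have := hasSum_integral_of_dominated_convergence (μ := μ)
    (F := fun (k : ℕ) t => (((dickson 1 (q : ℝ) (k + 1)).eval (ℓ t) : ℝ) : ℂ)
      / ((k + 1 : ℕ) : ℂ) * u ^ (k + 1)) (f := fun t => -quadraticLog q u (ℓ t))
    (fun k _ => 2 * ((q : ℝ) * ‖u‖) ^ (k + 1))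
    (fun k => ?_) (fun k => hμ.mono fun t ht => norm_term_le hq ht k)
    (Eventually.of_forall fun _ => summable_bound hu) (integrable_const _)
    (hμ.mono fun t ht => hasSum_neg_log_quadratic hq hu ht)
  · simpa only [integral_mul_const, integral_div, integral_complex_ofReal] using this
  · have : Continuous fun t => (dickson 1 (q : ℝ) (k + 1)).eval (ℓ t) :=
      (dickson 1 (q : ℝ) (k + 1)).continuous.comp hℓ
    exact (by fun_prop : Continuous _).aestronglyMeasurable

theorem WeaklyConverges.tendsto_integral_quadraticLog {μs : ℕ → Measure ℝ}
    [IsProbabilityMeasure μ] [∀ n, IsProbabilityMeasure (μs n)] (h : WeaklyConverges μs μ)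
    (hq : 1 ≤ q) (hu : (q : ℝ) * ‖u‖ < 1) (hℓ : Continuous ℓ)
    (hμs : ∀ n, ∀ᵐ t ∂(μs n), |ℓ t| ≤ q + 1) :
    Tendsto (fun n => ∫ t, quadraticLog q u (ℓ t) ∂(μs n)) atTop
      (𝓝 (∫ t, quadraticLog q u (ℓ t) ∂μ)) := by
  have hμ := h.ae_abs_le hℓ hμs
  -- Off the support the logarithm may meet its cut or be unbounded. Clamping `ℓ` gives a bounded
  -- continuous integrand that agrees almost everywhere with the original one.
  set c : ℝ → ℝ := fun t => max (-(q + 1)) (min (ℓ t) (q + 1)) with hc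
  have hcc : Continuous c := by fun_prop
  have hcb : ∀ t, |c t| ≤ q + 1 := fun t => by
    have : (0 : ℝ) ≤ q := by positivity
    exact abs_le.2 ⟨le_max_left _ _, max_le (by linarith) (min_le_right _ _)⟩
  have hce : ∀ t, |ℓ t| ≤ q + 1 → c t = ℓ t := fun t ht => by
    obtain ⟨h₁, h₂⟩ := abs_le.1 ht
    simp only [hc]
    rw [min_eq_left h₂, max_eq_right h₁]
  have hgc : Continuous fun t => quadraticLog q u (c t) := by
    refine Continuous.clog (by fun_prop) fun t => mem_slitPlane_quadratic hq hu (hcb t)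
  have hgb : ∀ t, ‖quadraticLog q u (c t)‖ ≤ ∑' k : ℕ, 2 * ((q : ℝ) * ‖u‖) ^ (k + 1) := fun t => by
    rw [quadraticLog, ← norm_neg, ← (hasSum_neg_log_quadratic hq hu (hcb t)).tsum_eq]
    exact tsum_of_norm_bounded (summable_bound hu).hasSum fun k => norm_term_le hq (hcb t) k
  -- Weak convergence is tested on real functions, so real and imaginary parts are separated.
  have hint : ∀ (ν : Measure ℝ) [IsProbabilityMeasure ν], (∀ᵐ t ∂ν, |ℓ t| ≤ q + 1) →
      ∫ t, quadraticLog q u (ℓ t) ∂ν = ((∫ t, (quadraticLog q u (c t)).re ∂ν : ℝ) : ℂ)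
        + ((∫ t, (quadraticLog q u (c t)).im ∂ν : ℝ) : ℂ) * Complex.I := by
    intro ν _ hν
    have hi : Integrable (fun t => quadraticLog q u (c t)) ν :=
      Integrable.of_bound hgc.aestronglyMeasurable _ (Eventually.of_forall hgb)
    rw [integral_congr_ae (g := fun t => quadraticLog q u (c t))
      (hν.mono fun t ht => by simp only [hce t ht])]
    exact (integral_re_add_im hi).symm
  simp only [hint μ hμ, fun n => hint (μs n) (hμs n)]
  have hre := h (BoundedContinuousFunction.ofNormedAddCommGroup
    (fun t => (quadraticLog q u (c t)).re) (Complex.continuous_re.comp hgc) _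
    fun t => (Complex.abs_re_le_norm _).trans (hgb t))
  have him := h (BoundedContinuousFunction.ofNormedAddCommGroup
    (fun t => (quadraticLog q u (c t)).im) (Complex.continuous_im.comp hgc) _
    fun t => (Complex.abs_im_le_norm _).trans (hgb t))
  simp only [BoundedContinuousFunction.coe_ofNormedAddCommGroup] at hre him
  exact ((Complex.continuous_ofReal.tendsto _).comp hre).add
    (((Complex.continuous_ofReal.tendsto _).comp him).mul_const _)

/-- The formula for the zeta function, given the cycle counts as moments of a measure. -/
theorem summable_zetaTerm_and_iharaZeta_inv {V : Type*} {G : SimpleGraph V} {x : V}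
    [IsFiniteMeasure μ] (hq : 1 ≤ q) (hu : (q : ℝ) * ‖u‖ < 1) (hℓ : Continuous ℓ)
    (hμ : ∀ᵐ t ∂μ, |ℓ t| ≤ q + 1)
    (hN : ∀ k, (numReducedCycles G x (k + 1) : ℝ) = ∫ t, (dickson 1 (q : ℝ) (k + 1)).eval (ℓ t) ∂μ
      + ((q : ℝ) - 1) / 2 * (1 + (-1) ^ (k + 1))) :
    Summable (zetaTerm G x u) ∧ (iharaZeta G x u)⁻¹ = (1 - u ^ 2) ^ (((q : ℂ) - 1) / 2)
      * Complex.exp (∫ t, quadraticLog q u (ℓ t) ∂μ) := by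
  have hu1 : ‖u‖ < 1 := by
    have : (1 : ℝ) ≤ q := by exact_mod_cast hq
    nlinarith [norm_nonneg u]
  have h := (hasSum_integral_quadraticLog hq hu hℓ hμ).add
    ((hasSum_neg_log_one_sub_sq hu1).mul_left (((q : ℂ) - 1) / 2))
  have h' : HasSum (zetaTerm G x u) (-(∫ t, quadraticLog q u (ℓ t) ∂μ)
      + ((q : ℂ) - 1) / 2 * -Complex.log (1 - u ^ 2)) := by
    convert h using 2 with k
    have := congrArg (fun r : ℝ => (r : ℂ)) (hN k)
    simp only [Complex.ofReal_natCast] at this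
    rw [zetaTerm, this]
    push_cast
    ring
  refine ⟨h'.summable, ?_⟩
  have hne : 1 - u ^ 2 ≠ 0 := by
    intro h0
    have : ‖u‖ ^ 2 = 1 := by
      rw [← norm_pow, ← sub_eq_zero.1 h0, norm_one]
    nlinarith [norm_nonneg u]
  rw [iharaZeta, h'.tsum_eq, ← Complex.exp_neg, Complex.cpow_def_of_ne_zero hne, ← Complex.exp_add]
  congr 1
  ring

end LogIntegral

/-! ### Spectral measures of self-adjoint operators -/

section OperatorSpectralMeasure

variable {E : Type w} [NormedAddCommGroup E] [InnerProductSpace ℂ E] [CompleteSpace E]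
  {T : E →L[ℂ] E} {ξ : E}

theorem spectrum_subset_Icc_norm (T : E →L[ℂ] E) : spectrum ℝ T ⊆ Set.Icc (-‖T‖) ‖T‖ := by
  intro t ht
  have h := spectrum.norm_le_norm_mul_of_mem ht
  have h1 : ‖(1 : E →L[ℂ] E)‖ ≤ 1 := ContinuousLinearMap.norm_id_le
  exact abs_le.1 (h.trans (mul_le_of_le_one_right (norm_nonneg _) h1))

theorem integral_operatorSpectralMeasure (f : C_c(ℝ, ℝ)) :
    ∫ t, f t ∂(operatorSpectralMeasure T ξ) = (⟪ξ, (cfc (f : ℝ → ℝ) T) ξ⟫_ℂ).re :=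
  RealRMK.integral_rieszMeasure _ f

/-- By regularity it suffices to bound compact sets `K` off the interval. A Urysohn function equal
to `1` on `K` and `0` on the interval vanishes on the spectrum, so its functional calculus is zero.
-/
theorem ae_operatorSpectralMeasure (T : E →L[ℂ] E) (ξ : E) :
    ∀ᵐ t ∂(operatorSpectralMeasure T ξ), t ∈ Set.Icc (-‖T‖) ‖T‖ := by
  rw [ae_iff]
  change operatorSpectralMeasure T ξ (Set.Icc (-‖T‖) ‖T‖)ᶜ = 0
  have : (operatorSpectralMeasure T ξ).Regular := RealRMK.regular_rieszMeasure _
  rw [isClosed_Icc.isOpen_compl.measure_eq_iSup_isCompact]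
  simp only [ENNReal.iSup_eq_zero]
  intro K hK hKc
  obtain ⟨f, hf1, hf0, hfc, hf⟩ := exists_continuous_one_zero_of_isCompact hKc isClosed_Icc
    (Set.disjoint_left.2 hK : Disjoint K (Set.Icc (-‖T‖) ‖T‖))
  have h := RealRMK.rieszMeasure_le_of_eq_one (spectralFunctional T ξ) (f := ⟨f, hfc⟩)
    (fun x => (hf x).1) hKc hf1
  have h0 : spectralFunctional T ξ ⟨f, hfc⟩ = 0 := by
    change (⟪ξ, (cfc (f : ℝ → ℝ) T) ξ⟫_ℂ).re = 0
    have : cfc (f : ℝ → ℝ) T = cfc (fun _ => (0 : ℝ)) T :=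
      cfc_congr fun t ht => hf0 (spectrum_subset_Icc_norm T ht)
    rw [this, cfc_const_zero]
    simp
  rw [h0, ENNReal.ofReal_zero] at h
  exact le_antisymm h bot_le

theorem integral_eval_operatorSpectralMeasure (hT : IsSelfAdjoint T) (p : ℝ[X]) :
    ∫ t, p.eval t ∂(operatorSpectralMeasure T ξ) = (⟪ξ, (aeval T p) ξ⟫_ℂ).re := by
  obtain ⟨f, hf1, -, hfc, -⟩ := exists_continuous_one_zero_of_isCompact
    (isCompact_Icc (a := -‖T‖) (b := ‖T‖)) isClosed_empty (Set.disjoint_empty _)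
  -- The measure is defined through compactly supported functions. The cutoff `f` is `1` on the
  -- interval, so neither the integral nor the functional calculus notices it.
  let g : C_c(ℝ, ℝ) := ⟨⟨fun t => p.eval t * f t, p.continuous.mul f.continuous⟩, hfc.mul_left⟩
  have hg : ∀ t ∈ Set.Icc (-‖T‖) ‖T‖, g t = p.eval t := fun t ht => by
    change p.eval t * f t = p.eval t
    rw [hf1 ht, Pi.one_apply, mul_one]
  rw [← integral_congr_ae ((ae_operatorSpectralMeasure T ξ).mono hg),
    integral_operatorSpectralMeasure, cfc_congr fun t ht => hg t (spectrum_subset_Icc_norm T ht),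
    cfc_polynomial p T hT]

theorem isProbabilityMeasure_operatorSpectralMeasure (hT : IsSelfAdjoint T) (hξ : ‖ξ‖ = 1) :
    IsProbabilityMeasure (operatorSpectralMeasure T ξ) := by
  have : (operatorSpectralMeasure T ξ).Regular := RealRMK.regular_rieszMeasure _
  have h := integral_eval_operatorSpectralMeasure (ξ := ξ) hT 1
  simp only [eval_one, integral_const, smul_eq_mul, mul_one, map_one,
    one_apply_eq_self, inner_self_eq_norm_sq_to_K, hξ] at h
  have h' : (operatorSpectralMeasure T ξ).real Set.univ = 1 := by simpa using h
  refine ⟨?_⟩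
  rw [measureReal_def] at h'
  rw [← ENNReal.ofReal_toReal (a := operatorSpectralMeasure T ξ Set.univ), h', ENNReal.ofReal_one]
  -- An infinite mass would have real value `0`, not `1`.
  intro htop
  simp [htop] at h'

omit [CompleteSpace E] in
theorem re_inner_aeval (T : E →L[ℂ] E) (ξ : E) (p : ℝ[X]) :
    (⟪ξ, (aeval T p) ξ⟫_ℂ).re = p.sum fun k c => c * (⟪ξ, (T ^ k) ξ⟫_ℂ).re := by
  rw [aeval_eq_sum_range, sum_over_range _ (by simp), sum_apply, inner_sum, Complex.re_sum]
  refine Finset.sum_congr rfl fun k _ => ?_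
  rw [smul_apply, inner_smul_right_eq_smul, Complex.smul_re, smul_eq_mul]

/-- Moments of a polynomial in `T` reduce to moments of `T`; applied to `P` and `Δ` as polynomials
in the adjacency operator. -/
theorem integral_eval_operatorSpectralMeasure_aeval (hT : IsSelfAdjoint T) (L p : ℝ[X]) :
    IsSelfAdjoint (aeval T L) ∧ ∫ t, p.eval t ∂(operatorSpectralMeasure (aeval T L) ξ)
      = (p.comp L).sum fun k c => c * (⟪ξ, (T ^ k) ξ⟫_ℂ).re := by
  have h : IsSelfAdjoint (aeval T L) := by
    rw [← cfc_polynomial L T hT]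
    exact cfc_predicate _ _
  exact ⟨h, by rw [integral_eval_operatorSpectralMeasure h, ← aeval_comp, re_inner_aeval]⟩

theorem integral_eval_operatorSpectralMeasure_smul (hT : IsSelfAdjoint T) (r : ℝ) (p : ℝ[X]) :
    IsSelfAdjoint ((r : ℂ) • T) ∧ ∫ t, p.eval t ∂(operatorSpectralMeasure ((r : ℂ) • T) ξ)
      = (p.comp (C r * X)).sum fun k c => c * (⟪ξ, (T ^ k) ξ⟫_ℂ).re := by
  have h : aeval T (C r * X) = (r : ℂ) • T := by
    rw [map_mul, aeval_C, aeval_X, ← Algebra.smul_def, Complex.coe_smul]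
  rw [← h]
  exact integral_eval_operatorSpectralMeasure_aeval hT _ p

theorem integral_eval_operatorSpectralMeasure_smul_one_sub (hT : IsSelfAdjoint T) (r : ℝ)
    (p : ℝ[X]) : IsSelfAdjoint ((r : ℂ) • (1 : E →L[ℂ] E) - T) ∧
      ∫ t, p.eval t ∂(operatorSpectralMeasure ((r : ℂ) • (1 : E →L[ℂ] E) - T) ξ)
        = (p.comp (C r - X)).sum fun k c => c * (⟪ξ, (T ^ k) ξ⟫_ℂ).re := by
  have h : aeval T (C r - X) = (r : ℂ) • (1 : E →L[ℂ] E) - T := by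
    rw [map_sub, aeval_C, aeval_X, Algebra.algebraMap_eq_smul_one, Complex.coe_smul]
  rw [← h]
  exact integral_eval_operatorSpectralMeasure_aeval hT _ p

end OperatorSpectralMeasure

/-! ### The adjacency operator -/

section AdjacencyOperator

variable {W : Type w} [DecidableEq W] (H : SimpleGraph W) [H.LocallyFinite] {d : ℕ}
  (hd : H.IsRegularOfDegree d)

omit [DecidableEq W] in
theorem adjacencyOperator_apply (f : ℓ²(W, ℂ)) (x : W) :
    adjacencyOperator H hd f x = ∑ y ∈ H.neighborFinset x, f y := rfl

theorem adjacencyOperator_single_apply (x y : W) :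
    adjacencyOperator H hd (lp.single 2 y (1 : ℂ)) x = if y ∈ H.neighborFinset x then 1 else 0 := by
  rw [adjacencyOperator_apply]
  simp [Pi.single_apply, eq_comm]

/-- Symmetry of adjacency gives agreement with the adjoint on each `δ_y`; continuity extends it
along `f = ∑ f y • δ_y`. -/
theorem isSelfAdjoint_adjacencyOperator : IsSelfAdjoint (adjacencyOperator H hd) := by
  rw [ContinuousLinearMap.isSelfAdjoint_iff']
  have key : ∀ y, ContinuousLinearMap.adjoint (adjacencyOperator H hd) (lp.single 2 y (1 : ℂ))
      = adjacencyOperator H hd (lp.single 2 y (1 : ℂ)) := by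
    intro y
    ext x
    have h := ContinuousLinearMap.adjoint_inner_right (adjacencyOperator H hd)
      (lp.single 2 x (1 : ℂ)) (lp.single 2 y (1 : ℂ))
    rw [lp.inner_single_left, lp.inner_single_right, adjacencyOperator_single_apply] at h
    rw [adjacencyOperator_single_apply]
    by_cases hxy : H.Adj x y
    · simpa [hxy, hxy.symm] using h
    · have hyx : ¬H.Adj y x := fun h' => hxy h'.symm
      simpa [hxy, hyx] using h
  ext1 f
  have hf := lp.hasSum_single (p := 2) (by simp) f
  have h₁ := hf.mapL (ContinuousLinearMap.adjoint (adjacencyOperator H hd))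
  have h₂ := hf.mapL (adjacencyOperator H hd)
  refine h₁.unique ?_
  convert h₂ using 2 with y
  have : lp.single 2 y (f y) = f y • (lp.single 2 y (1 : ℂ) : ℓ²(W, ℂ)) := by
    rw [← lp.single_smul, smul_eq_mul, mul_one]
  rw [this, map_smul, map_smul, key]

theorem adjacencyOperator_pow_single_apply (k : ℕ) (x y : W) :
    (adjacencyOperator H hd ^ k) (lp.single 2 y (1 : ℂ)) x = numWalks H x y k := by
  induction k generalizing x with
  | zero =>
    rw [pow_zero, one_apply_eq_self, lp.coeFn_single]
    by_cases h : x = y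
    · subst h; simp [numWalks_zero_self]
    · simp [numWalks_zero_of_ne H h, h]
  | succ k ih =>
    rw [pow_succ', mul_apply_eq_comp, adjacencyOperator_apply, numWalks_succ, Nat.cast_sum]
    exact Finset.sum_congr rfl fun z _ => ih z

theorem inner_adjacencyOperator_pow_single (k : ℕ) (o : W) :
    (⟪(lp.single 2 o (1 : ℂ) : ℓ²(W, ℂ)),
      (adjacencyOperator H hd ^ k) (lp.single 2 o (1 : ℂ))⟫_ℂ).re = numWalks H o o k := by
  rw [lp.inner_single_left, adjacencyOperator_pow_single_apply]
  simp

end AdjacencyOperator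

/-! ### The zeta function of a finite vertex-transitive graph -/

section Finite

variable {V : Type v} [Fintype V] [DecidableEq V] {G : SimpleGraph V} [DecidableRel G.Adj]
  {q : ℕ} {M : Matrix V V ℝ} {L : ℝ[X]} {u : ℂ}

theorem abs_eigenvalue_adjMatrix_le (hG : G.IsRegularOfDegree (q + 1))
    (hA : (G.adjMatrix ℝ).IsHermitian) (i : V) : |hA.eigenvalues i| ≤ q + 1 := by
  obtain ⟨k, hk⟩ := exists_abs_eigenvalue_sub_le hA i
  rw [SimpleGraph.adjMatrix_apply, if_neg (G.irrefl), sub_zero] at hk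
  refine hk.trans ((Finset.sum_le_sum_of_subset_of_nonneg (Finset.subset_univ _)
    fun _ _ _ => abs_nonneg _).trans_eq ?_)
  have h : ∀ j, |G.adjMatrix ℝ k j| = if G.Adj k j then 1 else 0 := fun j => by
    rw [SimpleGraph.adjMatrix_apply]; split_ifs <;> simp
  have h' := G.card_neighborFinset_eq_degree k
  rw [hG k, SimpleGraph.neighborFinset_eq_filter] at h'
  simp only [h, Finset.sum_boole, h']
  push_cast; ring

/-- If the adjacency matrix is a polynomial in `M`, that polynomial maps the spectrum of `M` to
`[-(q + 1), q + 1]`. -/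
theorem abs_eval_eigenvalue_le (hG : G.IsRegularOfDegree (q + 1)) (hM : M.IsHermitian)
    (hL : aeval M L = G.adjMatrix ℝ) (i : V) : |L.eval (hM.eigenvalues i)| ≤ q + 1 := by
  have h := spectrum.subset_polynomial_aeval M L ⟨_, hM.eigenvalues_mem_spectrum_real i, rfl⟩
  have hA : (G.adjMatrix ℝ).IsHermitian := G.isHermitian_adjMatrix ℝ
  simp only [hL] at h
  rw [hA.spectrum_real_eq_range_eigenvalues] at h
  obtain ⟨j, hj⟩ := h
  rw [← hj]
  exact abs_eigenvalue_adjMatrix_le hG hA j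

theorem ae_spectralMeasure_abs_eval_le (hG : G.IsRegularOfDegree (q + 1)) (hM : M.IsHermitian)
    (hL : aeval M L = G.adjMatrix ℝ) : ∀ᵐ t ∂(spectralMeasure M), |L.eval t| ≤ q + 1 :=
  ae_spectralMeasure hM (abs_eval_eigenvalue_le hG hM hL)

theorem numReducedCycles_eq_integral (hG : G.IsRegularOfDegree (q + 1))
    (htrans : VertexTransitive G) (x : V) (hM : M.IsHermitian)
    (hL : aeval M L = G.adjMatrix ℝ) (k : ℕ) :
    (numReducedCycles G x (k + 1) : ℝ)
      = ∫ t, (dickson 1 (q : ℝ) (k + 1)).eval (L.eval t) ∂(spectralMeasure M)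
        + ((q : ℝ) - 1) / 2 * (1 + (-1) ^ (k + 1)) := by
  simp only [← eval_comp]
  rw [integral_eval_spectralMeasure hM, aeval_comp, hL, numReducedCycles_eq_trace hG htrans]

/-- The bound does not depend on the graph, which makes it a dominating sequence. The Dickson
integral contributes `2 q ^ (k + 1)` and the parity term at most `q - 1`. -/
theorem numReducedCycles_le (hq : 1 ≤ q) (hG : G.IsRegularOfDegree (q + 1))
    (htrans : VertexTransitive G) (x : V) (k : ℕ) :
    (numReducedCycles G x (k + 1) : ℝ) ≤ 3 * (q : ℝ) ^ (k + 1) := by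
  have hq' : (1 : ℝ) ≤ q := by exact_mod_cast hq
  have hA : (G.adjMatrix ℝ).IsHermitian := G.isHermitian_adjMatrix ℝ
  have : Nonempty V := ⟨x⟩
  have := isProbabilityMeasure_spectralMeasure hA
  have hX : aeval (G.adjMatrix ℝ) (X : ℝ[X]) = G.adjMatrix ℝ := aeval_X _
  rw [numReducedCycles_eq_integral hG htrans x hA hX]
  have h₁ := norm_integral_le_of_norm_le_const
    (f := fun t => (dickson 1 (q : ℝ) (k + 1)).eval ((X : ℝ[X]).eval t))
    ((ae_spectralMeasure_abs_eval_le hG hA hX).mono fun t ht => abs_dickson_eval_le hq ht (k + 1))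
  rw [Real.norm_eq_abs, probReal_univ, mul_one] at h₁
  have h₂ : ((q : ℝ) - 1) / 2 * (1 + (-1) ^ (k + 1)) ≤ (q : ℝ) ^ (k + 1) := by
    have h₃ : (-1 : ℝ) ^ (k + 1) ≤ 1 := by
      rcases neg_one_pow_eq_or ℝ (k + 1) with h | h <;> norm_num [h]
    have h₄ : (q : ℝ) ≤ (q : ℝ) ^ (k + 1) := le_self_pow₀ hq' (by simp)
    nlinarith
  linarith [le_abs_self (∫ t, (dickson 1 (q : ℝ) (k + 1)).eval ((X : ℝ[X]).eval t)
    ∂(spectralMeasure (G.adjMatrix ℝ)))]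

theorem summable_zetaTerm_and_iharaZeta_inv_of_fintype (hq : 1 ≤ q) (hu : (q : ℝ) * ‖u‖ < 1)
    (hG : G.IsRegularOfDegree (q + 1)) (htrans : VertexTransitive G) (x : V)
    (hM : M.IsHermitian) (hL : aeval M L = G.adjMatrix ℝ) :
    Summable (zetaTerm G x u) ∧ (iharaZeta G x u)⁻¹ = (1 - u ^ 2) ^ (((q : ℂ) - 1) / 2)
      * Complex.exp (∫ t, quadraticLog q u (L.eval t) ∂(spectralMeasure M)) := by
  have : Nonempty V := ⟨x⟩
  have := isProbabilityMeasure_spectralMeasure hM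
  exact summable_zetaTerm_and_iharaZeta_inv hq hu L.continuous
    (ae_spectralMeasure_abs_eval_le hG hM hL) (numReducedCycles_eq_integral hG htrans x hM hL)

theorem transitionMatrix_eq_smul_adjMatrix (hG : G.IsRegularOfDegree (q + 1)) :
    transitionMatrix G = ((q : ℝ) + 1)⁻¹ • G.adjMatrix ℝ := by
  ext x y
  simp [transitionMatrix, hG x]

theorem lapMatrix_eq_sub (hG : G.IsRegularOfDegree (q + 1)) :
    G.lapMatrix ℝ = ((q : ℝ) + 1) • (1 : Matrix V V ℝ) - G.adjMatrix ℝ := by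
  rw [SimpleGraph.lapMatrix]
  congr 1
  ext x y
  by_cases h : x = y
  · subst h; simp [SimpleGraph.degMatrix, hG x]
  · simp [SimpleGraph.degMatrix, h]

theorem aeval_adjMatrix_eq_transitionMatrix (hG : G.IsRegularOfDegree (q + 1)) :
    aeval (G.adjMatrix ℝ) (C ((q : ℝ) + 1)⁻¹ * X) = transitionMatrix G := by
  rw [transitionMatrix_eq_smul_adjMatrix hG, map_mul, aeval_C, aeval_X, Algebra.smul_def]

theorem aeval_adjMatrix_eq_lapMatrix (hG : G.IsRegularOfDegree (q + 1)) :
    aeval (G.adjMatrix ℝ) (C ((q : ℝ) + 1) - X) = G.lapMatrix ℝ := by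
  rw [lapMatrix_eq_sub hG, map_sub, aeval_C, aeval_X, Algebra.algebraMap_eq_smul_one]

theorem aeval_transitionMatrix (hG : G.IsRegularOfDegree (q + 1)) :
    aeval (transitionMatrix G) (C ((q : ℝ) + 1) * X) = G.adjMatrix ℝ := by
  have hq : (q : ℝ) + 1 ≠ 0 := by positivity
  rw [transitionMatrix_eq_smul_adjMatrix hG, map_mul, aeval_C, aeval_X, ← Algebra.smul_def,
    smul_smul, mul_inv_cancel₀ hq, one_smul]

theorem aeval_lapMatrix (hG : G.IsRegularOfDegree (q + 1)) :
    aeval (G.lapMatrix ℝ) (C ((q : ℝ) + 1) - X) = G.adjMatrix ℝ := by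
  rw [lapMatrix_eq_sub hG, map_sub, aeval_C, aeval_X, Algebra.algebraMap_eq_smul_one,
    sub_sub_cancel]

theorem isHermitian_transitionMatrix (hG : G.IsRegularOfDegree (q + 1)) :
    (transitionMatrix G).IsHermitian := by
  rw [transitionMatrix_eq_smul_adjMatrix hG, Matrix.IsHermitian, Matrix.conjTranspose_smul,
    (G.isHermitian_adjMatrix ℝ).eq, star_trivial]

omit [DecidableEq V] in
-- If `q = 0`, then `|V| = 2 |E|`, while connectedness gives `|V| ≤ |E| + 1`; hence `|V| ≤ 2`.
theorem one_le_of_isRegularOfDegree (hG : G.IsRegularOfDegree (q + 1)) (hconn : G.Connected)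
    (hcard : 2 < Fintype.card V) : 1 ≤ q := by
  by_contra hq
  obtain rfl : q = 0 := by omega
  have h₁ := hconn.card_vert_le_card_edgeSet_add_one
  have h₂ := G.sum_degrees_eq_twice_card_edges
  rw [Finset.sum_congr rfl fun v _ => hG v, Finset.sum_const, Finset.card_univ, smul_eq_mul] at h₂
  rw [Nat.card_eq_fintype_card, Nat.card_eq_fintype_card, ← SimpleGraph.edgeFinset_card] at h₁
  omega

end Finite

/-! ### Limits along sequences of finite graphs -/

section Limits

variable {V : ℕ → Type v} [∀ n, Fintype (V n)] [∀ n, DecidableEq (V n)]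
  {G : ∀ n, SimpleGraph (V n)} [∀ n, DecidableRel (G n).Adj] {q : ℕ} {x : ∀ n, V n} {u : ℂ}
  {M : ∀ n, Matrix (V n) (V n) ℝ} {L : ℝ[X]}

theorem WeaklyConverges.integrable_and_tendsto_iharaZeta_inv (hq : 1 ≤ q)
    (hu : (q : ℝ) * ‖u‖ < 1) (hG : ∀ n, (G n).IsRegularOfDegree (q + 1))
    (htrans : ∀ n, VertexTransitive (G n)) (hM : ∀ n, (M n).IsHermitian)
    (hL : ∀ n, aeval (M n) L = (G n).adjMatrix ℝ) {μ : Measure ℝ} [IsProbabilityMeasure μ]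
    (h : WeaklyConverges (fun n => spectralMeasure (M n)) μ) :
    Integrable (fun t => quadraticLog q u (L.eval t)) μ ∧
      Tendsto (fun n => (iharaZeta (G n) (x n) u)⁻¹) atTop
        (𝓝 ((1 - u ^ 2) ^ (((q : ℂ) - 1) / 2)
          * Complex.exp (∫ t, quadraticLog q u (L.eval t) ∂μ))) := by
  have : ∀ n, Nonempty (V n) := fun n => ⟨x n⟩
  have := fun n => isProbabilityMeasure_spectralMeasure (hM n)
  have hae := fun n => ae_spectralMeasure_abs_eval_le (hG n) (hM n) (hL n)
  refine ⟨integrable_quadraticLog hq hu L.continuous (h.ae_abs_le L.continuous hae), ?_⟩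
  simp only [fun n => (summable_zetaTerm_and_iharaZeta_inv_of_fintype hq hu (hG n) (htrans n) (x n)
    (hM n) (hL n)).2]
  exact ((Complex.continuous_exp.tendsto _).comp
    (h.tendsto_integral_quadraticLog hq hu L.continuous hae)).const_mul _

variable {W : Type w} {H : SimpleGraph W} [H.LocallyFinite] {o : W}

omit [∀ n, DecidableEq (V n)] in
theorem LocallyConverges.eventually_eq (h : LocallyConverges G x H o) (r : ℕ) :
    ∀ᶠ n in atTop, ∀ m ≤ r, numReducedCycles (G n) (x n) m = numReducedCycles H o m ∧
      numWalks (G n) (x n) (x n) m = numWalks H o o m := by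
  filter_upwards [h r] with n hn m hm
  obtain ⟨φ, hφ⟩ := hn
  exact numReducedCycles_eq_and_numWalks_eq_of_closedBall_iso hm φ hφ

theorem LocallyConverges.summable_and_tendsto_iharaZeta (h : LocallyConverges G x H o)
    (hq : 1 ≤ q) (hu : (q : ℝ) * ‖u‖ < 1) (hG : ∀ n, (G n).IsRegularOfDegree (q + 1))
    (htrans : ∀ n, VertexTransitive (G n)) :
    Summable (zetaTerm H o u) ∧
      Tendsto (fun n => iharaZeta (G n) (x n) u) atTop (𝓝 (iharaZeta H o u)) := by
  have hsum : Summable fun k : ℕ => 3 * ((q : ℝ) * ‖u‖) ^ (k + 1) :=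
    ((summable_nat_add_iff 1).2 (summable_geometric_of_lt_one (by positivity) hu)).mul_left 3
  have hbd : ∀ n k, ‖zetaTerm (G n) (x n) u k‖ ≤ 3 * ((q : ℝ) * ‖u‖) ^ (k + 1) := by
    intro n k
    rw [zetaTerm, norm_mul, norm_div, Complex.norm_natCast, Complex.norm_natCast, norm_pow, mul_pow,
      ← mul_assoc]
    refine mul_le_mul_of_nonneg_right ?_ (by positivity)
    refine (div_le_self (by positivity) ?_).trans (numReducedCycles_le hq (hG n) (htrans n) _ k)
    exact_mod_cast Nat.le_add_left 1 k
  have hev : ∀ k, ∀ᶠ n in atTop, zetaTerm (G n) (x n) u k = zetaTerm H o u k := by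
    intro k
    filter_upwards [h.eventually_eq (k + 1)] with n hn
    rw [zetaTerm, zetaTerm, (hn (k + 1) le_rfl).1]
  refine ⟨Summable.of_norm_bounded hsum fun k => ?_, ?_⟩
  -- The bound for `H` is inherited from some `G n` with the same term.
  · obtain ⟨n, hn⟩ := (hev k).exists
    rw [← hn]
    exact hbd n k
  · refine (Complex.continuous_exp.tendsto _).comp ?_
    exact tendsto_tsum_of_dominated_convergence hsum
      (fun k => tendsto_const_nhds.congr' ((hev k).mono fun n hn => hn.symm))
      (Eventually.of_forall hbd)

/-- For fixed `p` the integrals are eventually equal, not merely close: both are one combination of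
closed-walk counts up to the degree of `p.comp L'`. `L` recovers `A` from `M` and, with `hR`, bounds
the spectrum; `L'` expresses `M` through `A`. -/
theorem LocallyConverges.weaklyConverges [DecidableEq W] (h : LocallyConverges G x H o)
    (hG : ∀ n, (G n).IsRegularOfDegree (q + 1)) (htrans : ∀ n, VertexTransitive (G n))
    (hH : H.IsRegularOfDegree (q + 1)) (hM : ∀ n, (M n).IsHermitian)
    (hL : ∀ n, aeval (M n) L = (G n).adjMatrix ℝ) {R : ℝ}
    (hR : ∀ t, |L.eval t| ≤ (q : ℝ) + 1 → |t| ≤ R) {L' : ℝ[X]}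
    (hL' : ∀ n, aeval ((G n).adjMatrix ℝ) L' = M n) {T : ℓ²(W, ℂ) →L[ℂ] ℓ²(W, ℂ)}
    (hT : ∀ p : ℝ[X], IsSelfAdjoint T ∧
      ∫ t, p.eval t ∂(operatorSpectralMeasure T (lp.single 2 o (1 : ℂ)))
        = (p.comp L').sum fun k c => c * (⟪(lp.single 2 o (1 : ℂ) : ℓ²(W, ℂ)),
          (adjacencyOperator H hH ^ k) (lp.single 2 o (1 : ℂ))⟫_ℂ).re) :
    WeaklyConverges (fun n => spectralMeasure (M n))
      (operatorSpectralMeasure T (lp.single 2 o (1 : ℂ))) ∧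
    IsProbabilityMeasure (operatorSpectralMeasure T (lp.single 2 o (1 : ℂ))) := by
  have hprob : IsProbabilityMeasure (operatorSpectralMeasure T (lp.single 2 o (1 : ℂ))) :=
    isProbabilityMeasure_operatorSpectralMeasure (hT 0).1 (by rw [lp.norm_single (by simp), norm_one])
  have : ∀ n, Nonempty (V n) := fun n => ⟨x n⟩
  have := fun n => isProbabilityMeasure_spectralMeasure (hM n)
  refine ⟨weaklyConverges_of_tendsto_integral_eval (R := max R ‖T‖) (fun n => ?_) ?_ fun p => ?_,
    hprob⟩
  · filter_upwards [ae_spectralMeasure_abs_eval_le (hG n) (hM n) (hL n)] with t ht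
    exact abs_le.1 ((hR t ht).trans (le_max_left _ _))
  · filter_upwards [ae_operatorSpectralMeasure T (lp.single 2 o (1 : ℂ))] with t ht
    exact abs_le.1 ((abs_le.2 ht).trans (le_max_right _ _))
  · refine tendsto_const_nhds.congr' ?_
    filter_upwards [h.eventually_eq (p.comp L').natDegree] with n hn
    rw [(hT p).2, integral_eval_spectralMeasure (hM n), ← hL' n, ← aeval_comp,
      trace_aeval_adjMatrix (htrans n) (x n)]
    refine Finset.sum_congr rfl fun k hk => ?_
    beta_reduce
    rw [(hn k (le_natDegree_of_mem_supp k hk)).2, inner_adjacencyOperator_pow_single]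

end Limits

/-! ### The two integrands in common form, and the main theorem -/

theorem transitionLog_eq (q : ℕ) (u : ℂ) : transitionLog q u
    = fun t => quadraticLog q u ((C ((q : ℝ) + 1) * X : ℝ[X]).eval t) := by
  ext t
  rw [transitionLog, quadraticLog]
  congr 1
  simp only [eval_mul, eval_C, eval_X]
  push_cast; ring

theorem laplacianLog_eq (q : ℕ) (u : ℂ) : laplacianLog q u
    = fun t => quadraticLog q u ((C ((q : ℝ) + 1) - X : ℝ[X]).eval t) := by
  ext t
  rw [laplacianLog, quadraticLog]
  congr 1
  simp only [eval_sub, eval_C, eval_X]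
  push_cast; ring

end IharaLimit

theorem theorem9 (q : ℕ) (V : ℕ → Type*) [∀ n, Fintype (V n)] [∀ n, DecidableEq (V n)]
    (G : ∀ n, SimpleGraph (V n)) [∀ n, DecidableRel (G n).Adj]
    (hconn : ∀ n, (G n).Connected)
    (htrans : ∀ n, VertexTransitive (G n))
    (hreg : ∀ n, (G n).IsRegularOfDegree (q + 1))
    (hcard : Tendsto (fun n => Fintype.card (V n)) atTop atTop)
    (x : ∀ n, V n) (u : ℂ) (hu : (q : ℝ) * ‖u‖ < 1) :
    (∀ n, Summable (zetaTerm (G n) (x n) u)) ∧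
    (∀ (μP : Measure ℝ) [IsProbabilityMeasure μP],
      WeaklyConverges (fun n => spectralMeasure (transitionMatrix (G n))) μP →
        Integrable (transitionLog q u) μP ∧
        Tendsto (fun n => (iharaZeta (G n) (x n) u)⁻¹) atTop (𝓝 (transitionLimit q u μP))) ∧
    (∀ (μΔ : Measure ℝ) [IsProbabilityMeasure μΔ],
      WeaklyConverges (fun n => spectralMeasure ((G n).lapMatrix ℝ)) μΔ →
        Integrable (laplacianLog q u) μΔ ∧
        Tendsto (fun n => (iharaZeta (G n) (x n) u)⁻¹) atTop (𝓝 (laplacianLimit q u μΔ))) ∧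
    (∀ (W : Type*) [DecidableEq W] (H : SimpleGraph W) [H.LocallyFinite]
      (hH : H.IsRegularOfDegree (q + 1)) (o : W),
      H.Connected → VertexTransitive H → LocallyConverges G x H o →
        WeaklyConverges (fun n => spectralMeasure (transitionMatrix (G n)))
          (transitionSpectralMeasure H hH o) ∧
        WeaklyConverges (fun n => spectralMeasure ((G n).lapMatrix ℝ))
          (laplacianSpectralMeasure H hH o) ∧
        IsProbabilityMeasure (transitionSpectralMeasure H hH o) ∧
        IsProbabilityMeasure (laplacianSpectralMeasure H hH o) ∧
        Summable (zetaTerm H o u) ∧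
        Tendsto (fun n => (iharaZeta (G n) (x n) u)⁻¹) atTop (𝓝 (iharaZeta H o u)⁻¹) ∧
        (iharaZeta H o u)⁻¹ = transitionLimit q u (transitionSpectralMeasure H hH o) ∧
        (iharaZeta H o u)⁻¹ = laplacianLimit q u (laplacianSpectralMeasure H hH o)) := by
  obtain ⟨n₀, hn₀⟩ := (hcard.eventually_gt_atTop 2).exists
  have hq : 1 ≤ q := one_le_of_isRegularOfDegree (hreg n₀) (hconn n₀) hn₀
  have hqpos : (0 : ℝ) < (q : ℝ) + 1 := by positivity
  have hPH : ∀ n, (transitionMatrix (G n)).IsHermitian := fun n =>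
    isHermitian_transitionMatrix (hreg n)
  have hP := fun n => aeval_transitionMatrix (hreg n)
  have hΔ := fun n => aeval_lapMatrix (hreg n)
  have hΔH : ∀ n, ((G n).lapMatrix ℝ).IsHermitian := fun n => (G n).isHermitian_lapMatrix ℝ
  have part1 : ∀ (μ : Measure ℝ) [IsProbabilityMeasure μ],
      WeaklyConverges (fun n => spectralMeasure (transitionMatrix (G n))) μ →
        Integrable (transitionLog q u) μ ∧
        Tendsto (fun n => (iharaZeta (G n) (x n) u)⁻¹) atTop (𝓝 (transitionLimit q u μ)) := by
    intro μ _ h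
    rw [transitionLimit, transitionLog_eq]
    exact h.integrable_and_tendsto_iharaZeta_inv hq hu hreg htrans hPH hP
  have part2 : ∀ (μ : Measure ℝ) [IsProbabilityMeasure μ],
      WeaklyConverges (fun n => spectralMeasure ((G n).lapMatrix ℝ)) μ →
        Integrable (laplacianLog q u) μ ∧
        Tendsto (fun n => (iharaZeta (G n) (x n) u)⁻¹) atTop (𝓝 (laplacianLimit q u μ)) := by
    intro μ _ h
    rw [laplacianLimit, laplacianLog_eq]
    exact h.integrable_and_tendsto_iharaZeta_inv hq hu hreg htrans hΔH hΔ
  refine ⟨fun n => (summable_zetaTerm_and_iharaZeta_inv_of_fintype hq hu (hreg n) (htrans n) (x n)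
    (hPH n) (hP n)).1, part1, part2, ?_⟩
  intro W _ H _ hH o _ _ hloc
  -- `R = 1`, since `|(q + 1) t| ≤ q + 1`.
  obtain ⟨hwP, hpP⟩ := hloc.weaklyConverges (R := 1) (T := transitionOperator H hH) hreg htrans hH
    hPH hP (fun t ht => by
      simp only [Polynomial.eval_mul, Polynomial.eval_C, Polynomial.eval_X, abs_mul,
        abs_of_pos hqpos] at ht
      exact le_of_mul_le_mul_left (by linarith) hqpos) (fun n => aeval_adjMatrix_eq_transitionMatrix (hreg n)) (by
      have := integral_eval_operatorSpectralMeasure_smul (ξ := (lp.single 2 o (1 : ℂ) : ℓ²(W, ℂ)))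
        (isSelfAdjoint_adjacencyOperator H hH) ((q : ℝ) + 1)⁻¹
      have hr : ((((q : ℝ) + 1)⁻¹ : ℝ) : ℂ) = ((q + 1 : ℕ) : ℂ)⁻¹ := by push_cast; rfl
      rw [hr] at this
      exact this)
  -- `|q + 1 - t| ≤ q + 1` means `0 ≤ t ≤ 2 (q + 1)`.
  obtain ⟨hwΔ, hpΔ⟩ := hloc.weaklyConverges (R := 2 * ((q : ℝ) + 1)) (T := laplacianOperator H hH)
    hreg htrans hH hΔH hΔ (fun t ht => by
      simp only [Polynomial.eval_sub, Polynomial.eval_C, Polynomial.eval_X] at ht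
      obtain ⟨h₁, h₂⟩ := abs_le.1 ht
      exact abs_le.2 ⟨by linarith, by linarith⟩) (fun n => aeval_adjMatrix_eq_lapMatrix (hreg n)) (by
      have := integral_eval_operatorSpectralMeasure_smul_one_sub
        (ξ := (lp.single 2 o (1 : ℂ) : ℓ²(W, ℂ)))
        (isSelfAdjoint_adjacencyOperator H hH) ((q : ℝ) + 1)
      have hr : (((q : ℝ) + 1 : ℝ) : ℂ) = ((q + 1 : ℕ) : ℂ) := by push_cast; rfl
      rw [hr] at this
      exact this)
  obtain ⟨hs, ht⟩ := hloc.summable_and_tendsto_iharaZeta hq hu hreg htrans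
  have ht' := ht.inv₀ (Complex.exp_ne_zero _)
  -- The same sequence converges to `ζ_H(u)⁻¹` and to each limit expression, so these agree.
  exact ⟨hwP, hwΔ, hpP, hpΔ, hs, ht', tendsto_nhds_unique ht' (part1 _ hwP).2,
    tendsto_nhds_unique ht' (part2 _ hwΔ).2⟩
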